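/- **Theorem (Energy splitting and distancing have the same order).** Let $1\le k\le n$. Let $\mathrm{Herm}(n)$ be the real vector space of $n\times n$ Hermitian matrices with the Frobenius norm $\|A\|=\sqrt{\operatorname{tr}(A^2)}$, let $\lambda_1(A)\le\dots\le\lambda_n(A)$ be the ordered eigenvalues of $A$, and let $\Sigma_k\subset\mathrm{Herm}(n)$ be the set of matrices with $\lambda_1=\dots=\lambda_k<\lambda_{k+1}$ (the last inequality is void if $k=n$). Write $\overline\lambda=\frac1k\sum_{j\le k}\lambda_j$, $D_k=\sqrt{\frac1k\sum_{j\le k}(\lambda_j-\overline\lambda)^2}$ and $d(A,\Sigma_k)=\inf_{G\in\Sigma_k}\|A-G\|$. *Orders.* If $f:\mathbb R\to\mathbb R$ is given for small $t\ge 0$ by a convergent power series centred at $0$, then $\mathrm{ord}_0(f)\in\{0,1,2,\dots,\infty\}$ denotes the order of this series ($\infty$ for the zero series); for a (vector-valued) function analytic at $0$ it is the usual vanishing order. A minimum over the empty set is $\infty$. *Exact Schrieffer–Wolff decomposition.* Let $H_0'\in\Sigma_k$ be diagonal with increasing diagonal entries. A decomposition of $H\in\mathrm{Herm}(n)$ with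 respect to $H_0'$ is $$H=e^{iS}\,(H_0'+B+T+H_{\mathrm{eff}})\,e^{-iS}$$ with $S,B,T,H_{\mathrm{eff}}\in\mathrm{Herm}(n)$, where $S$ is off-block (its diagonal $k\times k$ and $(n-k)\times(n-k)$ blocks vanish), $B$ is supported in the bottom right $(n-k)\times(n-k)$ block, $T$ is a real scalar matrix in the upper left $k\times k$ block and zero elsewhere, $H_{\mathrm{eff}}\in\mathrm{Herm}_0(k)$ (traceless and supported in the upper left $k\times k$ block), and the first $k$ columns of $e^{iS}$ span the sum of the eigenspaces of $H$ for the eigenvalues $\lambda_1(H),\dots,\lambda_k(H)$. The decomposition with respect to $H_0'$ *is defined on* $\mathcal V$ if $\mathcal V$ is an open neighbourhood of $H_0'$ and there is an open neighbourhood $\mathcal U$ of $0$ in the space of tuples $(S,B,T,H_{\mathrm{eff}})$ such that every $H\in\mathcal V$ has exactly one decomposition with $(S,B,T,H_{\mathrm{eff}})\in\mathcal U$, and this tuple depends real analytically on $H\in\mathcal V$. For every such $H_0'$ there is a $\mathcal V$ on which the decomposition is defined. *Statement.* Let $H(t)\in\mathrm{Herm}(n)$ be a one-parameter family that is real analytic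 at $t=0$, with $H(0)\in\Sigma_k$, and write $\lambda_i(t)=\lambda_i(H(t))$, $\overline\lambda(t)=\overline\lambda(H(t))$. For small $t\ge0$ the functions $\mathfrak s_k(t)=D_k(H(t))$, $\mathfrak s_{i,j}(t)=\lambda_i(t)-\lambda_j(t)$, $\overline{\mathfrak s}_i(t)=\lambda_i(t)-\overline\lambda(t)$ ($1\le i,j\le k$) and $d(H(t),\Sigma_k)$ are given by convergent power series centred at $0$. The five quantities $$\mathrm{ord}_0(\mathfrak s_k),\quad \min_{1\le i<j\le k}\mathrm{ord}_0(\mathfrak s_{i,j}),\quad \min_{1\le i\le k-1}\mathrm{ord}_0(\mathfrak s_{i,i+1}),\quad \mathrm{ord}_0(\mathfrak s_{1,k}),\quad \min_{1\le i\le k}\mathrm{ord}_0(\overline{\mathfrak s}_i)$$ are equal; let $r$ be their common value, the order of energy splitting. Then $$r=\mathrm{ord}_0\bigl(t\mapsto d(H(t),\Sigma_k)\bigr)=\mathrm{ord}_0\bigl(t\mapsto H_{\mathrm{eff}}(t)\bigr)=\min_{1\le j\le k^2-1}\mathrm{ord}_0\bigl(t\mapsto y_j(t)\bigr)$$ for every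 diagonal $H_0'\in\Sigma_k$ with increasing diagonal entries (not necessarily equal to $H(0)$) and every $\mathcal V\ni H(0)$ on which the decomposition with respect to $H_0'$ is defined. Here $H_{\mathrm{eff}}(t)$ is the resulting effective Hamiltonian of $H(t)$, for $t$ near $0$, and $y_1(t),\dots,y_{k^2-1}(t)$ are its coordinates in any fixed basis of $\mathrm{Herm}_0(k)$ (in particular in any orthonormal one); $H_{\mathrm{eff}}(t)$ and the $y_j(t)$ are analytic at $t=0$. -/

import Mathlib

open scoped Matrix.Norms.Frobenius Topology

noncomputable section

namespace SchriefferWolff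

/-- The real vector space `Herm(n)` of `n × n` Hermitian matrices, with the Frobenius norm. -/
abbrev Herm (n : ℕ) : Type :=
  ↥(selfAdjoint.submodule ℝ (Matrix (Fin n) (Fin n) ℂ))

/-- The matrix underlying an element of `Herm n`. -/
abbrev Herm.mat {n : ℕ} (A : Herm n) : Matrix (Fin n) (Fin n) ℂ := A.1

theorem Herm.isHermitian {n : ℕ} (A : Herm n) : A.mat.IsHermitian := A.2

/-- The eigenvalues, with multiplicity, in increasing order (indices start at `0`). -/
def eig {n : ℕ} (A : Herm n) : Fin n → ℝ :=
  A.isHermitian.eigenvalues ∘ Tuple.sort A.isHermitian.eigenvalues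

/-- `Σ_k`: the `k`-fold ground-state degenerate matrices,
`λ₁ = ⋯ = λ_k < λ_{k+1}` (the last condition is void when `k = n`). -/
def degenerate (n k : ℕ) : Set (Herm n) :=
  {A | ∀ i j : Fin n, (i : ℕ) < k →
    ((j : ℕ) < k → eig A i = eig A j) ∧ (k ≤ (j : ℕ) → eig A i < eig A j)}

/-! ### Splitting of the lowest `k` eigenvalues -/

/-- The `k` lowest eigenvalues. -/
def lowEig {n k : ℕ} (hk : k ≤ n) (A : Herm n) (i : Fin k) : ℝ := eig A (Fin.castLE hk i)

/-- The mean of the `k` lowest eigenvalues. -/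
def meanEig {n k : ℕ} (hk : k ≤ n) (A : Herm n) : ℝ := (∑ j, lowEig hk A j) / k

/-- `D_k`: the standard deviation of the `k` lowest eigenvalues. -/
def stdDev {n k : ℕ} (hk : k ≤ n) (A : Herm n) : ℝ :=
  Real.sqrt ((∑ j, (lowEig hk A j - meanEig hk A) ^ 2) / k)

/-- `λ_i - λ_j` for two of the `k` lowest eigenvalues. -/
def splitting {n k : ℕ} (hk : k ≤ n) (i j : Fin k) (A : Herm n) : ℝ :=
  lowEig hk A i - lowEig hk A j

/-- `λ_i - mean` for one of the `k` lowest eigenvalues. -/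
def meanSplitting {n k : ℕ} (hk : k ≤ n) (i : Fin k) (A : Herm n) : ℝ :=
  lowEig hk A i - meanEig hk A

/-! ### Order at `0` of a function that is a power series for `t ≥ 0`

The splitting functions and the distance are in general not differentiable at `0`; their order is
the order of the power series representing them for small `t ≥ 0`. -/

/-- For small `t ≥ 0`, `f` is given by a convergent power series centred at `0`. -/
def RightAnalytic (f : ℝ → ℝ) : Prop :=
  ∃ g : ℝ → ℝ, AnalyticAt ℝ g 0 ∧ f =ᶠ[𝓝[≥] 0] g

open Classical in
/-- The order of that power series (`⊤` for the zero series); only meaningful if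
`RightAnalytic f`. -/
def rightOrd (f : ℝ → ℝ) : ℕ∞ :=
  if h : RightAnalytic f then analyticOrderAt h.choose 0 else 0

theorem rightOrd_eq {f g : ℝ → ℝ} (hg : AnalyticAt ℝ g 0) (hfg : f =ᶠ[𝓝[≥] 0] g) :
    rightOrd f = analyticOrderAt g 0 := by
  have h : RightAnalytic f := ⟨g, hg, hfg⟩
  rw [rightOrd, dif_pos h]
  apply analyticOrderAt_congr
  refine (h.choose_spec.1.frequently_eq_iff_eventually_eq hg).1 ?_
  have h1 : h.choose =ᶠ[𝓝[>] 0] g :=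
    (h.choose_spec.2.symm.trans hfg).filter_mono (nhdsWithin_mono _ Set.Ioi_subset_Ici_self)
  exact h1.frequently.filter_mono (nhdsWithin_mono _ fun x hx => ne_of_gt hx)

/-! ### The exact Schrieffer–Wolff decomposition -/

/-- Off-block matrices: the diagonal `k × k` and `(n-k) × (n-k)` blocks vanish. -/
def offBlock (n k : ℕ) : Submodule ℝ (Herm n) where
  carrier := {A | ∀ i j : Fin n, ((i : ℕ) < k ↔ (j : ℕ) < k) → A.mat i j = 0}
  add_mem' := fun ha hb i j h => by
    have h1 := ha i j h
    have h2 := hb i j h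
    simp_all [Herm.mat]
  zero_mem' := fun i j _ => by simp [Herm.mat]
  smul_mem' := fun c A hA i j h => by
    have h1 := hA i j h
    simp_all [Herm.mat]

/-- Matrices supported in the bottom right `(n-k) × (n-k)` block. -/
def lowerBlock (n k : ℕ) : Submodule ℝ (Herm n) where
  carrier := {A | ∀ i j : Fin n, ((i : ℕ) < k ∨ (j : ℕ) < k) → A.mat i j = 0}
  add_mem' := fun ha hb i j h => by
    have h1 := ha i j h
    have h2 := hb i j h
    simp_all [Herm.mat]
  zero_mem' := fun i j _ => by simp [Herm.mat]
  smul_mem' := fun c A hA i j h => by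
    have h1 := hA i j h
    simp_all [Herm.mat]

/-- `Herm₀(k) ⊆ Herm(n)`: traceless matrices supported in the upper left `k × k` block. -/
def hermZero (n k : ℕ) : Submodule ℝ (Herm n) where
  carrier := {A | (∀ i j : Fin n, (k ≤ (i : ℕ) ∨ k ≤ (j : ℕ)) → A.mat i j = 0) ∧ A.mat.trace = 0}
  add_mem' := fun ha hb => by
    refine ⟨fun i j h => ?_, ?_⟩
    · have h1 := ha.1 i j h
      have h2 := hb.1 i j h
      simp_all [Herm.mat]
    · have h1 := ha.2
      have h2 := hb.2
      simp_all [Herm.mat]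
  zero_mem' := ⟨fun i j _ => by simp [Herm.mat], by simp [Herm.mat]⟩
  smul_mem' := fun c A hA => by
    refine ⟨fun i j h => ?_, ?_⟩
    · have h1 := hA.1 i j h
      simp_all [Herm.mat]
    · have h1 := hA.2
      simp_all [Herm.mat]

/-- The identity of the upper left `k × k` block, extended by zero. -/
def blockOne (n k : ℕ) : Matrix (Fin n) (Fin n) ℂ :=
  Matrix.diagonal fun i => if (i : ℕ) < k then 1 else 0

/-- The ingredients `(S, B, c, H_eff)` of a decomposition; the scalar block is `T = c · blockOne`. -/
abbrev SWData (n k : ℕ) : Type := offBlock n k × lowerBlock n k × ℝ × hermZero n k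

namespace SWData

variable {n k : ℕ}

/-- The exponent `S`. -/
abbrev S (p : SWData n k) : Matrix (Fin n) (Fin n) ℂ := p.1.1.mat
/-- The block `B`. -/
abbrev B (p : SWData n k) : Matrix (Fin n) (Fin n) ℂ := p.2.1.1.mat
/-- The scalar block `T`. -/
abbrev T (p : SWData n k) : Matrix (Fin n) (Fin n) ℂ := (p.2.2.1 : ℂ) • blockOne n k
/-- The traceless effective Hamiltonian. -/
abbrev eff (p : SWData n k) : hermZero n k := p.2.2.2

end SWData

/-- `H = e^{iS} (H₀ + B + T + H_eff) e^{-iS}`, and the first `k` columns of `e^{iS}` span the sum of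
the eigenspaces of `H` for its `k` lowest eigenvalues. -/
structure IsSWDecomposition {n k : ℕ} (hk : k ≤ n) (H₀ H : Herm n) (p : SWData n k) : Prop where
  eq : H.mat = NormedSpace.exp (Complex.I • p.S) * (H₀.mat + p.B + p.T + p.eff.1.mat) *
    NormedSpace.exp (-(Complex.I • p.S))
  lowest : Submodule.span ℂ (Set.range fun j : Fin k =>
      (NormedSpace.exp (Complex.I • p.S)).col (Fin.castLE hk j)) =
    ⨆ j : Fin k, Module.End.eigenspace (Matrix.toLin' H.mat) (lowEig hk H j : ℂ)

/-- A base point: a diagonal element of `Σ_k` whose diagonal entries increase. -/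
structure IsBasePoint {n : ℕ} (k : ℕ) (H₀ : Herm n) : Prop where
  mem : H₀ ∈ degenerate n k
  diag : H₀.mat.IsDiag
  mono : Monotone fun i => (H₀.mat i i).re

/-- A domain on which the exact decomposition with respect to `H₀` is defined: an open neighbourhood
`V` of `H₀` and an open neighbourhood `U` of `0` such that each `H ∈ V` has exactly one decomposition
with data in `U`, depending real analytically on `H`. -/
structure SWDomain {n k : ℕ} (hk : k ≤ n) (H₀ : Herm n) where
  V : Set (Herm n)
  U : Set (SWData n k)
  isOpen_V : IsOpen V
  base_mem : H₀ ∈ V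
  isOpen_U : IsOpen U
  zero_mem : (0 : SWData n k) ∈ U
  data : Herm n → SWData n k
  data_mem : ∀ H ∈ V, data H ∈ U
  isDecomposition : ∀ H ∈ V, IsSWDecomposition hk H₀ H (data H)
  unique : ∀ H ∈ V, ∀ p ∈ U, IsSWDecomposition hk H₀ H p → p = data H
  analytic : AnalyticOnNhd ℝ data V

end SchriefferWolff

end

namespace SchriefferWolff

open Matrix Polynomial

variable {n : ℕ}

/-! ### Ordered eigenvalues and diagonalization -/

/-! Everything is compared with one quantity, the standard deviation `D_k` of the `k` lowest
eigenvalues. Two exact identities do the main work. If there is a gap after the `k`-th eigenvalue,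
then `d(H, Σ_k) = √k · D_k(H)` (`infDist_degenerate`): replacing the low eigenvalues by their mean
gives a competitor at this distance, and the Hoffman–Wielandt inequality shows that nothing in `Σ_k`
is closer. For every decomposition, `‖H_eff‖ = √k · D_k(H)` (`IsSWDecomposition.norm_eff`): the
first `k` columns of `e^{iS}` and the `k` lowest eigenvectors define the same projection `P`, so the
traces of `P H` and `P (H - μ)²` can be computed in either frame.

The five measures of splitting bound one another up to constants depending only on `k`
(`splitting_isBigO_tfae`). The order of a right power series is at least `N` exactly when the
function is `O(t^N)` as `t → 0⁺`, so comparable functions have equal orders.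

That these functions are power series rests on a one-sided Rellich theorem, `rightAnalytic_eig`,
proved by induction on the size. Subtract the normalized trace and divide by the leading power of
`t`; what remains starts at a nonzero traceless matrix, hence one with two distinct eigenvalues, and
the Schrieffer–Wolff map splits it into two smaller analytic blocks. That map is locally invertible
by the inverse function theorem: its derivative `i[S, H₀] + B + T + H_eff` is bijective because the
gap of `H₀` makes the commutator invertible on off-block matrices. -/

theorem eig_monotone (A : Herm n) : Monotone (eig A) := Tuple.monotone_sort _

theorem eq_of_monotone_of_map_univ_eq {f g : Fin n → ℝ} (hf : Monotone f) (hg : Monotone g)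
    (h : Finset.univ.val.map f = Finset.univ.val.map g) : f = g := by
  apply List.ofFn_injective
  refine List.Perm.eq_of_sortedLE hf.sortedLE_ofFn hg.sortedLE_ofFn ?_
  rw [← Multiset.coe_eq_coe]
  simpa [Fin.univ_val_map] using h

theorem charpoly_eq_prod_eig (A : Herm n) :
    A.mat.charpoly = ∏ i, (X - C (eig A i : ℂ)) := by
  rw [A.isHermitian.charpoly_eq]
  exact (Equiv.prod_comp (Tuple.sort A.isHermitian.eigenvalues)
    (fun i => (X - C ((A.isHermitian.eigenvalues i : ℝ) : ℂ)))).symm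

/-- The roots of the characteristic polynomial give the eigenvalues as a multiset, and a finite
multiset of reals has only one increasing enumeration. -/
theorem eig_eq_of_charpoly {A : Herm n} {f : Fin n → ℝ} (hf : Monotone f)
    (h : A.mat.charpoly = ∏ i, (X - C (f i : ℂ))) : eig A = f := by
  refine eq_of_monotone_of_map_univ_eq (eig_monotone A) hf ?_
  have h1 := congrArg Polynomial.roots ((charpoly_eq_prod_eig A).symm.trans h)
  have key (g : Fin n → ℝ) : (∏ i, (X - C (g i : ℂ))).roots =
      (Finset.univ.val.map g).map (fun x : ℝ => (x : ℂ)) := by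
    rw [Polynomial.roots_prod _ _ (Finset.prod_ne_zero_iff.2 fun i _ => X_sub_C_ne_zero _)]
    simp only [roots_X_sub_C, Multiset.bind_singleton, Multiset.map_map, Function.comp_def]
  rw [key, key] at h1
  exact Multiset.map_injective Complex.ofReal_injective h1

/-- A unitary diagonalization with increasing diagonal entries exhibits the ordered eigenvalues. -/
theorem eig_eq_of_diagonalization {A : Herm n} {f : Fin n → ℝ} (hf : Monotone f)
    {U : Matrix (Fin n) (Fin n) ℂ} (hU : U ∈ unitary (Matrix (Fin n) (Fin n) ℂ))
    (h : A.mat = U * diagonal (fun i => (f i : ℂ)) * star U) : eig A = f := by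
  refine eig_eq_of_charpoly hf ?_
  rw [h, charpoly_mul_comm, ← mul_assoc, Unitary.star_mul_self_of_mem hU, one_mul,
    charpoly_diagonal]

theorem exists_eig_diagonalization (A : Herm n) :
    ∃ W ∈ unitary (Matrix (Fin n) (Fin n) ℂ),
      A.mat = W * diagonal (fun i => (eig A i : ℂ)) * star W := by
  have hs := A.isHermitian.spectral_theorem
  rw [Unitary.conjStarAlgAut_apply] at hs
  set σ := Tuple.sort A.isHermitian.eigenvalues with hσ
  set U := A.isHermitian.eigenvectorUnitary
  have hU : (U : Matrix (Fin n) (Fin n) ℂ) ∈ unitaryGroup (Fin n) ℂ := U.2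
  refine ⟨(U : Matrix _ _ ℂ).submatrix id σ, ?_, ?_⟩
  · refine mem_unitaryGroup_iff.2 ?_
    rw [star_eq_conjTranspose, conjTranspose_submatrix, submatrix_mul_equiv,
      ← star_eq_conjTranspose, mem_unitaryGroup_iff.1 hU, submatrix_id_id]
  · have hd : diagonal (fun i => (eig A i : ℂ)) =
        (diagonal (RCLike.ofReal ∘ A.isHermitian.eigenvalues)).submatrix σ σ := by
      rw [submatrix_diagonal_equiv]
      rfl
    rw [hd, star_eq_conjTranspose, conjTranspose_submatrix, submatrix_mul_equiv,
      submatrix_mul_equiv, ← star_eq_conjTranspose, submatrix_id_id]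
    exact hs

/-! ### The Frobenius norm -/

theorem frobenius_norm_sq (A : Matrix (Fin n) (Fin n) ℂ) : ‖A‖ ^ 2 = ∑ i, ∑ j, ‖A i j‖ ^ 2 := by
  rw [frobenius_norm_def, ← Real.sqrt_eq_rpow, Real.sq_sqrt]
  · simp
  · positivity

/-- The trace form gives unitary invariance of the norm and lets algebraic trace identities show
that a matrix vanishes. -/
theorem frobenius_norm_sq_eq_trace (A : Matrix (Fin n) (Fin n) ℂ) :
    ((‖A‖ ^ 2 : ℝ) : ℂ) = trace (star A * A) := by
  rw [frobenius_norm_sq, Finset.sum_comm]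
  simp only [trace, diag_apply, mul_apply, star_apply, Complex.ofReal_sum]
  refine Finset.sum_congr rfl fun i _ => Finset.sum_congr rfl fun j _ => ?_
  rw [RCLike.star_def, Complex.conj_mul', Complex.ofReal_pow]

theorem frobenius_norm_unitary_mul {U : Matrix (Fin n) (Fin n) ℂ}
    (hU : U ∈ unitary (Matrix (Fin n) (Fin n) ℂ)) (A : Matrix (Fin n) (Fin n) ℂ) :
    ‖U * A‖ = ‖A‖ := by
  have h : ‖U * A‖ ^ 2 = ‖A‖ ^ 2 := by
    apply Complex.ofReal_injective
    rw [frobenius_norm_sq_eq_trace, frobenius_norm_sq_eq_trace, star_mul, mul_assoc,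
      ← mul_assoc (star U), Unitary.star_mul_self_of_mem hU, one_mul]
  exact (sq_eq_sq₀ (norm_nonneg _) (norm_nonneg _)).1 h

theorem frobenius_norm_mul_unitary {U : Matrix (Fin n) (Fin n) ℂ}
    (hU : U ∈ unitary (Matrix (Fin n) (Fin n) ℂ)) (A : Matrix (Fin n) (Fin n) ℂ) :
    ‖A * U‖ = ‖A‖ := by
  rw [← frobenius_norm_conjTranspose, conjTranspose_mul, ← star_eq_conjTranspose U,
    frobenius_norm_unitary_mul (Unitary.star_mem hU), frobenius_norm_conjTranspose]

/-! ### The Hoffman–Wielandt inequality -/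

theorem normSq_unitary_mem_doublyStochastic {X : Matrix (Fin n) (Fin n) ℂ}
    (hX : X ∈ unitary (Matrix (Fin n) (Fin n) ℂ)) :
    (Matrix.of fun i j => ‖X i j‖ ^ 2) ∈ doublyStochastic ℝ (Fin n) := by
  rw [mem_doublyStochastic_iff_sum]
  refine ⟨fun i j => by simp, fun i => ?_, fun j => ?_⟩
  · have := congrArg (fun Y : Matrix (Fin n) (Fin n) ℂ => Y i i) (Unitary.mul_star_self_of_mem hX)
    apply Complex.ofReal_injective
    simpa [mul_apply, Complex.mul_conj'] using this
  · have := congrArg (fun Y : Matrix (Fin n) (Fin n) ℂ => Y j j) (Unitary.star_mul_self_of_mem hX)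
    apply Complex.ofReal_injective
    simpa [mul_apply, Complex.conj_mul'] using this

/-- By Birkhoff's theorem `M` is a convex combination of permutation matrices; for each permutation
the bound is the rearrangement inequality. -/
theorem sum_sq_sub_le_sum_doublyStochastic {a b : Fin n → ℝ} (ha : Monotone a) (hb : Monotone b)
    {M : Matrix (Fin n) (Fin n) ℝ} (hM : M ∈ doublyStochastic ℝ (Fin n)) :
    ∑ i, (a i - b i) ^ 2 ≤ ∑ i, ∑ j, M i j * (a i - b j) ^ 2 := by
  obtain ⟨w, hw0, hw1, rfl⟩ := exists_eq_sum_perm_of_mem_doublyStochastic hM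
  have hperm (σ : Equiv.Perm (Fin n)) :
      ∑ i, (a i - b i) ^ 2 ≤ ∑ i, (a i - b (σ i)) ^ 2 := by
    have h1 : ∑ i, a i * b (σ i) ≤ ∑ i, a i * b i :=
      (ha.monovary hb).sum_mul_comp_perm_le_sum_mul
    have h2 : ∑ i, b (σ i) ^ 2 = ∑ i, b i ^ 2 := Equiv.sum_comp σ fun i => b i ^ 2
    have h3 (c : Fin n → ℝ) : ∑ i, (a i - c i) ^ 2 =
        ∑ i, a i ^ 2 - 2 * ∑ i, a i * c i + ∑ i, c i ^ 2 := by
      rw [Finset.mul_sum, ← Finset.sum_sub_distrib, ← Finset.sum_add_distrib]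
      exact Finset.sum_congr rfl fun i _ => by ring
    rw [h3, h3 fun i => b (σ i), h2]
    linarith
  calc ∑ i, (a i - b i) ^ 2 = ∑ σ, w σ * ∑ i, (a i - b i) ^ 2 := by
        rw [← Finset.sum_mul, hw1, one_mul]
    _ ≤ ∑ σ, w σ * ∑ i, (a i - b (σ i)) ^ 2 :=
        Finset.sum_le_sum fun σ _ => mul_le_mul_of_nonneg_left (hperm σ) (hw0 σ)
    _ = ∑ σ, ∑ i, ∑ j, (w σ • σ.permMatrix ℝ) i j * (a i - b j) ^ 2 := by
        refine Finset.sum_congr rfl fun σ _ => ?_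
        rw [Finset.mul_sum]
        refine Finset.sum_congr rfl fun i _ => ?_
        simp [Equiv.Perm.permMatrix, PEquiv.toMatrix_apply, eq_comm]
    _ = _ := by
        rw [Finset.sum_comm]
        refine Finset.sum_congr rfl fun i _ => ?_
        rw [Finset.sum_comm]
        refine Finset.sum_congr rfl fun j _ => ?_
        rw [Matrix.sum_apply, Finset.sum_mul]

/-- The **Hoffman–Wielandt inequality** for Hermitian matrices. -/
theorem sum_sq_eig_sub_le (A B : Herm n) : ∑ i, (eig A i - eig B i) ^ 2 ≤ ‖A - B‖ ^ 2 := by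
  obtain ⟨U, hU, hA⟩ := exists_eig_diagonalization A
  obtain ⟨V, hV, hB⟩ := exists_eig_diagonalization B
  have hX := mul_mem (Unitary.star_mem hU) hV
  have h1 : ‖A - B‖ = ‖star U * (A.mat - B.mat) * V‖ := by
    rw [frobenius_norm_mul_unitary hV, frobenius_norm_unitary_mul (Unitary.star_mem hU)]
    rfl
  -- With `X = U* V`, the entries of this matrix are `(a i - b j) X i j`, so its squared norm is a
  -- sum weighted by the doubly stochastic matrix `|X i j|²`.
  have h2 : star U * (A.mat - B.mat) * V =
      diagonal (fun i => (eig A i : ℂ)) * (star U * V) -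
        (star U * V) * diagonal (fun i => (eig B i : ℂ)) := by
    have hU' := Unitary.star_mul_self_of_mem hU
    have hV' := Unitary.star_mul_self_of_mem hV
    rw [mul_sub, sub_mul]
    congr 1
    · rw [hA]
      simp only [← mul_assoc]
      rw [hU', one_mul]
    · rw [hB]
      simp only [mul_assoc]
      rw [hV', mul_one]
  refine (sum_sq_sub_le_sum_doublyStochastic (eig_monotone A) (eig_monotone B)
    (normSq_unitary_mem_doublyStochastic hX)).trans_eq ?_
  rw [h1, h2, frobenius_norm_sq]
  refine Finset.sum_congr rfl fun i _ => Finset.sum_congr rfl fun j _ => ?_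
  rw [Matrix.sub_apply, diagonal_mul, mul_diagonal, mul_comm (_ : ℂ) ((eig B j : ℝ) : ℂ), ← sub_mul,
    norm_mul, mul_pow, ← Complex.ofReal_sub, Complex.norm_real, Real.norm_eq_abs, sq_abs,
    mul_comm, of_apply]

theorem abs_eig_sub_le (A B : Herm n) (i : Fin n) : |eig A i - eig B i| ≤ ‖A - B‖ := by
  refine abs_le_of_sq_le_sq ?_ (norm_nonneg _)
  exact (Finset.single_le_sum (f := fun i => (eig A i - eig B i) ^ 2)
    (fun _ _ => sq_nonneg _) (Finset.mem_univ i)).trans (sum_sq_eig_sub_le A B)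

theorem continuous_eig (i : Fin n) : Continuous fun A : Herm n => eig A i := by
  refine LipschitzWith.continuous (K := 1) (LipschitzWith.of_dist_le_mul fun A B => ?_)
  rw [Real.dist_eq, dist_eq_norm, NNReal.coe_one, one_mul]
  exact abs_eig_sub_le A B i

end SchriefferWolff

namespace SchriefferWolff

open Filter Asymptotics

/-! ### Orders at `0` in terms of one-sided growth -/

/-- The vanishing order at `0` of an analytic function is detected by its growth on the right. -/
theorem natCast_le_analyticOrderAt_iff_isBigO {E : Type*} [NormedAddCommGroup E] [NormedSpace ℝ E]
    {f : ℝ → E} (hf : AnalyticAt ℝ f 0) {N : ℕ} :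
    (N : ℕ∞) ≤ analyticOrderAt f 0 ↔ f =O[𝓝[>] 0] fun t => t ^ N := by
  constructor
  · intro h
    obtain ⟨g, hg, hfg⟩ := (natCast_le_analyticOrderAt hf).1 h
    have h1 : g =O[𝓝[>] 0] fun _ => (1 : ℝ) :=
      (hg.continuousAt.mono_left nhdsWithin_le_nhds).isBigO_one ℝ
    have h2 : f =ᶠ[𝓝[>] 0] fun t => t ^ N • g t := by
      filter_upwards [hfg.filter_mono nhdsWithin_le_nhds] with t ht
      simpa using ht
    refine h2.trans_isBigO ?_
    simpa using (isBigO_refl (fun t : ℝ => t ^ N) (𝓝[>] 0)).smul h1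
  · intro h
    by_contra hlt
    rw [not_le] at hlt
    -- If the order were `m < N`, then `f = t^m g` with `g 0 ≠ 0`, but the growth bound gives `g =
    -- O(t^(N-m))`, which tends to `0`.
    obtain ⟨m, hm⟩ := ENat.ne_top_iff_exists.1 (ne_top_of_lt hlt)
    rw [← hm, Nat.cast_lt] at hlt
    obtain ⟨g, hg, hg0, hfg⟩ := hf.analyticOrderAt_eq_natCast.1 hm.symm
    obtain ⟨C, hC⟩ := h.bound
    have h1 : ∀ᶠ t in 𝓝[>] (0 : ℝ), ‖g t‖ ≤ C * t ^ (N - m) := by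
      filter_upwards [hfg.filter_mono nhdsWithin_le_nhds, hC, self_mem_nhdsWithin] with t ht hCt ht0
      have ht0 : 0 < t := ht0
      rw [ht, sub_zero, norm_smul, norm_pow, norm_pow, Real.norm_of_nonneg ht0.le] at hCt
      have h3 : t ^ N = t ^ m * t ^ (N - m) := by rw [← pow_add]; congr 1; omega
      rw [h3] at hCt
      have : t ^ m * ‖g t‖ ≤ t ^ m * (C * t ^ (N - m)) := by linarith
      exact le_of_mul_le_mul_left this (pow_pos ht0 m)
    have h2 : Tendsto (fun t : ℝ => C * t ^ (N - m)) (𝓝[>] 0) (𝓝 0) := by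
      have : Continuous fun t : ℝ => C * t ^ (N - m) := by fun_prop
      have h3 := this.tendsto 0
      rw [zero_pow (by omega), mul_zero] at h3
      exact h3.mono_left nhdsWithin_le_nhds
    have h4 : Tendsto g (𝓝[>] 0) (𝓝 0) := squeeze_zero_norm' h1 h2
    exact hg0 (tendsto_nhds_unique (hg.continuousAt.mono_left nhdsWithin_le_nhds) h4)

/-- The bridge that turns every equality of orders into a comparison of one-sided growth. -/
theorem RightAnalytic.natCast_le_rightOrd_iff {f : ℝ → ℝ} (hf : RightAnalytic f) {N : ℕ} :
    (N : ℕ∞) ≤ rightOrd f ↔ f =O[𝓝[>] 0] fun t => t ^ N := by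
  obtain ⟨g, hg, hfg⟩ := hf
  rw [rightOrd_eq hg hfg, natCast_le_analyticOrderAt_iff_isBigO hg]
  exact isBigO_congr (hfg.symm.filter_mono (nhdsWithin_mono _ Set.Ioi_subset_Ici_self)) .rfl

theorem RightAnalytic.congr {f g : ℝ → ℝ} (hg : RightAnalytic g) (h : f =ᶠ[𝓝[≥] 0] g) :
    RightAnalytic f := by
  obtain ⟨u, hu, hgu⟩ := hg
  exact ⟨u, hu, h.trans hgu⟩

theorem RightAnalytic.sub {f g : ℝ → ℝ} (hf : RightAnalytic f) (hg : RightAnalytic g) :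
    RightAnalytic fun t => f t - g t := by
  obtain ⟨u, hu, hfu⟩ := hf
  obtain ⟨v, hv, hgv⟩ := hg
  exact ⟨fun t => u t - v t, hu.fun_sub hv, hfu.sub hgv⟩

theorem RightAnalytic.add {f g : ℝ → ℝ} (hf : RightAnalytic f) (hg : RightAnalytic g) :
    RightAnalytic fun t => f t + g t := by
  obtain ⟨u, hu, hfu⟩ := hf
  obtain ⟨v, hv, hgv⟩ := hg
  exact ⟨fun t => u t + v t, hu.fun_add hv, hfu.add hgv⟩

theorem RightAnalytic.mul {f g : ℝ → ℝ} (hf : RightAnalytic f) (hg : RightAnalytic g) :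
    RightAnalytic fun t => f t * g t := by
  obtain ⟨u, hu, hfu⟩ := hf
  obtain ⟨v, hv, hgv⟩ := hg
  exact ⟨fun t => u t * v t, hu.fun_mul hv, hfu.mul hgv⟩

theorem _root_.AnalyticAt.rightAnalytic {f : ℝ → ℝ} (hf : AnalyticAt ℝ f 0) : RightAnalytic f :=
  ⟨f, hf, .rfl⟩

theorem RightAnalytic.sum {ι : Type*} {s : Finset ι} {f : ι → ℝ → ℝ}
    (hf : ∀ i, RightAnalytic (f i)) : RightAnalytic fun t => ∑ i ∈ s, f i t := by
  classical
  induction s using Finset.induction_on with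
  | empty => simpa using (analyticAt_const (𝕜 := ℝ) (v := (0 : ℝ)) (x := (0 : ℝ))).rightAnalytic
  | insert i s his ih =>
    simp only [Finset.sum_insert his]
    exact (hf i).add ih

/-- The norm of a curve that is analytic at `0` is a power series on the right of `0`. -/
theorem rightAnalytic_norm {E : Type*} [NormedAddCommGroup E] [InnerProductSpace ℝ E]
    {F : ℝ → E} (hF : AnalyticAt ℝ F 0) : RightAnalytic fun t => ‖F t‖ := by
  by_cases htop : analyticOrderAt F 0 = ⊤
  · refine ⟨fun _ => 0, analyticAt_const, ?_⟩
    filter_upwards [(analyticOrderAt_eq_top.1 htop).filter_mono nhdsWithin_le_nhds] with t ht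
    rw [ht, norm_zero]
  -- Factor `F = t^m g` with `g 0 ≠ 0`: the norm is analytic away from the origin, and `|t^m| = t^m`
  -- for `t ≥ 0`.
  · obtain ⟨m, hm⟩ := ENat.ne_top_iff_exists.1 htop
    obtain ⟨g, hg, hg0, hFg⟩ := hF.analyticOrderAt_eq_natCast.1 hm.symm
    have hn : AnalyticAt ℝ (fun t => ‖g t‖) 0 :=
      AnalyticAt.fun_comp (contDiffAt_norm ℝ hg0).analyticAt hg
    refine ⟨fun t => t ^ m * ‖g t‖, by fun_prop, ?_⟩
    filter_upwards [hFg.filter_mono nhdsWithin_le_nhds, self_mem_nhdsWithin] with t ht ht0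
    have ht0 : 0 ≤ t := ht0
    rw [ht, sub_zero, norm_smul, norm_pow, Real.norm_of_nonneg ht0]

/-- A Euclidean norm of an analytic curve of representatives; this bypasses the singularity of the
square root at `0`. -/
theorem RightAnalytic.sqrt_sum_sq {ι : Type*} [Fintype ι] {f : ι → ℝ → ℝ}
    (hf : ∀ i, RightAnalytic (f i)) : RightAnalytic fun t => Real.sqrt (∑ i, f i t ^ 2) := by
  choose g hg hfg using hf
  have hG : AnalyticAt ℝ (fun t => (EuclideanSpace.equiv ι ℝ).symm fun i => g i t) 0 :=
    ((EuclideanSpace.equiv ι ℝ).symm.toContinuousLinearMap.analyticAt _).fun_comp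
      (analyticAt_pi_iff.2 hg)
  refine (rightAnalytic_norm hG).congr ?_
  filter_upwards [eventually_all.2 hfg] with t ht
  simp [EuclideanSpace.norm_eq, ht]

/-! ### Spread of finitely many ordered reals -/

section Spread

variable {k : ℕ} {l : Fin k → ℝ}

/-- The deviation from the mean is the average of the pairwise differences. -/
theorem abs_sub_mean_le {c : ℝ} (hk : 1 ≤ k) (h : ∀ i j, |l i - l j| ≤ c) (i : Fin k) :
    |l i - (∑ j, l j) / k| ≤ c := by
  have hk0 : (0 : ℝ) < k := by exact_mod_cast hk
  have h1 : l i - (∑ j, l j) / k = (∑ j, (l i - l j)) / k := by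
    rw [Finset.sum_sub_distrib]
    simp
    field_simp
  rw [h1, abs_div, abs_of_pos hk0, div_le_iff₀ hk0]
  calc |∑ j, (l i - l j)| ≤ ∑ j, |l i - l j| := Finset.abs_sum_le_sum_abs _ _
    _ ≤ ∑ _j : Fin k, c := Finset.sum_le_sum fun j _ => h i j
    _ = c * k := by simp [mul_comm]

theorem sqrt_mean_sq_le {c : ℝ} (hc : 0 ≤ c) (h : ∀ i, |l i| ≤ c) :
    Real.sqrt ((∑ i, l i ^ 2) / k) ≤ c := by
  rw [Real.sqrt_le_left hc]
  rcases Nat.eq_zero_or_pos k with rfl | hk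
  · simp [sq_nonneg]
  have hk0 : (0 : ℝ) < k := by exact_mod_cast hk
  rw [div_le_iff₀ hk0]
  calc ∑ i, l i ^ 2 ≤ ∑ _i : Fin k, c ^ 2 :=
        Finset.sum_le_sum fun i _ => sq_le_sq' (abs_le.1 (h i)).1 (abs_le.1 (h i)).2
    _ = c ^ 2 * k := by simp [mul_comm]

theorem abs_le_sqrt_mean_sq (i : Fin k) :
    |l i| ≤ Real.sqrt k * Real.sqrt ((∑ j, l j ^ 2) / k) := by
  have hk0 : (0 : ℝ) < k := by exact_mod_cast i.pos
  rw [← Real.sqrt_mul hk0.le, mul_div_cancel₀ _ hk0.ne', ← Real.sqrt_sq_eq_abs]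
  exact Real.sqrt_le_sqrt (Finset.single_le_sum (f := fun i => l i ^ 2)
    (fun _ _ => sq_nonneg _) (Finset.mem_univ i))

end Spread

/-- For families of `k` reals, the growth on the right of `0` of the individual differences, of the
consecutive differences, of the extreme difference, of the deviations from the mean and of the
standard deviation coincide. -/
theorem splitting_isBigO_tfae {k : ℕ} (hk : 1 ≤ k) {l : Fin k → ℝ → ℝ}
    (hl : ∀ t, Monotone fun i => l i t) (N : ℕ) :
    List.TFAE [
      (fun t => Real.sqrt ((∑ i, (l i t - (∑ j, l j t) / k) ^ 2) / k)) =O[𝓝[>] 0] (fun t => t ^ N),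
      ∀ i j : Fin k, i < j → (fun t => l i t - l j t) =O[𝓝[>] 0] (fun t => t ^ N),
      ∀ i j : Fin k, (i : ℕ) + 1 = j → (fun t => l i t - l j t) =O[𝓝[>] 0] (fun t => t ^ N),
      (fun t => l ⟨0, by omega⟩ t - l ⟨k - 1, by omega⟩ t) =O[𝓝[>] 0] (fun t => t ^ N),
      ∀ i : Fin k, (fun t => l i t - (∑ j, l j t) / k) =O[𝓝[>] 0] (fun t => t ^ N)] := by
  have hspread (t : ℝ) (i j : Fin k) :
      |l i t - l j t| ≤ |l ⟨0, by omega⟩ t - l ⟨k - 1, by omega⟩ t| := by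
    have h1 (i : Fin k) : l ⟨0, by omega⟩ t ≤ l i t := hl t (by simp [Fin.le_def])
    have h2 (i : Fin k) : l i t ≤ l ⟨k - 1, by omega⟩ t := hl t (by simp [Fin.le_def]; omega)
    rw [abs_sub_comm (l ⟨0, _⟩ t)]
    refine (abs_le.2 ⟨?_, ?_⟩).trans (le_abs_self _)
    · linarith [h1 i, h2 j]
    · linarith [h1 j, h2 i]
  tfae_have 2 → 3 := fun h i j hij => h i j (by rw [Fin.lt_def]; omega)
  tfae_have 3 → 4 := by
    intro h
    -- The extreme difference telescopes into consecutive ones.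
    have key : ∀ m : ℕ, ∀ hm : m < k,
        (fun t => l ⟨0, by omega⟩ t - l ⟨m, hm⟩ t) =O[𝓝[>] 0] (fun t => t ^ N) := by
      intro m
      induction m with
      | zero => intro hm; simpa using isBigO_zero _ _
      | succ m ih =>
        intro hm
        have := (ih (by omega)).add (h ⟨m, by omega⟩ ⟨m + 1, hm⟩ rfl)
        simpa using this
    exact key _ _
  tfae_have 4 → 5 := fun h i => (isBigO_of_le _ fun t =>
    abs_sub_mean_le hk (hspread t) i).trans h
  tfae_have 5 → 2 := fun h i j _ => by simpa using (h i).sub (h j)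
  tfae_have 4 → 1 := fun h => (isBigO_of_le _ fun t => by
    rw [Real.norm_of_nonneg (Real.sqrt_nonneg _)]
    exact sqrt_mean_sq_le (abs_nonneg _) fun i => abs_sub_mean_le hk (hspread t) i).trans h
  tfae_have 1 → 5 := fun h i => (IsBigO.of_bound (Real.sqrt k) (.of_forall fun t => by
    rw [Real.norm_of_nonneg (Real.sqrt_nonneg _)]
    exact abs_le_sqrt_mean_sq (l := fun i => l i t - (∑ j, l j t) / k) i)).trans h
  tfae_finish

end SchriefferWolff

namespace SchriefferWolff

open Matrix

variable {n k : ℕ}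

/-- Indicator form of a sum over the first `k` indices, for comparison with full sums and with
traces against `blockOne`. -/
theorem sum_castLE {M : Type*} [AddCommMonoid M] (hk : k ≤ n) (f : Fin n → M) :
    ∑ i : Fin k, f (Fin.castLE hk i) = ∑ i : Fin n, if (i : ℕ) < k then f i else 0 := by
  obtain ⟨m, rfl⟩ := Nat.exists_eq_add_of_le hk
  rw [Fin.sum_univ_add]
  simp
  rfl

/-! ### Distance from the degenerate matrices -/

/-- The Hermitian matrix with eigenvector matrix `W` and real eigenvalues `f`. -/
def ofDiagonalization (W : Matrix (Fin n) (Fin n) ℂ) (f : Fin n → ℝ) : Herm n :=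
  ⟨W * diagonal (fun i => (f i : ℂ)) * star W, by
    refine IsSelfAdjoint.conjugate (x := diagonal fun i => (f i : ℂ)) ?_ W
    exact isHermitian_diagonal_of_self_adjoint _ (by ext i; simp)⟩

theorem eig_ofDiagonalization {W : Matrix (Fin n) (Fin n) ℂ}
    (hW : W ∈ unitary (Matrix (Fin n) (Fin n) ℂ)) {f : Fin n → ℝ} (hf : Monotone f) :
    eig (ofDiagonalization W f) = f :=
  eig_eq_of_diagonalization hf hW rfl

/-- With a common eigenbasis the difference is unitarily diagonal, so only the eigenvalue
differences remain. -/
theorem norm_sq_sub_ofDiagonalization {W : Matrix (Fin n) (Fin n) ℂ}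
    (hW : W ∈ unitary (Matrix (Fin n) (Fin n) ℂ)) (f g : Fin n → ℝ) :
    ‖ofDiagonalization W f - ofDiagonalization W g‖ ^ 2 = ∑ i, (f i - g i) ^ 2 := by
  have h1 : (ofDiagonalization W f - ofDiagonalization W g).mat =
      W * diagonal (fun i => ((f i - g i : ℝ) : ℂ)) * star W := by
    change W * _ * star W - W * _ * star W = _
    rw [← sub_mul, ← mul_sub, diagonal_sub]
    simp
  have h2 : ‖ofDiagonalization W f - ofDiagonalization W g‖ =
      ‖diagonal (fun i => ((f i - g i : ℝ) : ℂ))‖ := by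
    rw [← frobenius_norm_unitary_mul hW, ← frobenius_norm_mul_unitary (Unitary.star_mem hW), ← h1]
    rfl
  rw [h2, frobenius_norm_diagonal, EuclideanSpace.norm_sq_eq]
  simp only [Complex.norm_real, Real.norm_eq_abs, sq_abs]

theorem sqrt_mul_stdDev (hk₁ : 1 ≤ k) (hk : k ≤ n) (A : Herm n) :
    Real.sqrt k * stdDev hk A = Real.sqrt (∑ j, (lowEig hk A j - meanEig hk A) ^ 2) := by
  have hk0 : (0 : ℝ) < k := by exact_mod_cast hk₁
  rw [stdDev, ← Real.sqrt_mul hk0.le, mul_div_cancel₀ _ hk0.ne']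

/-- As a function of `c` the right side is a parabola with vertex at the mean; the two sides differ
by `k (c - mean)²`. -/
theorem sum_sq_sub_mean_le (l : Fin k → ℝ) (c : ℝ) :
    ∑ i, (l i - (∑ j, l j) / k) ^ 2 ≤ ∑ i, (l i - c) ^ 2 := by
  rcases Nat.eq_zero_or_pos k with rfl | hk
  · simp
  have hk0 : (0 : ℝ) < k := by exact_mod_cast hk
  have h (x : ℝ) : ∑ i, (l i - x) ^ 2 = ∑ i, l i ^ 2 - 2 * x * ∑ i, l i + k * x ^ 2 := by
    simp only [sub_sq, Finset.sum_add_distrib, Finset.sum_sub_distrib, Finset.mul_sum]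
    simp
    exact Finset.sum_congr rfl fun i _ => by ring
  rw [h, h]
  have : (∑ i, l i ^ 2 - 2 * c * ∑ i, l i + k * c ^ 2) -
      (∑ i, l i ^ 2 - 2 * ((∑ j, l j) / k) * ∑ i, l i + k * ((∑ j, l j) / k) ^ 2) =
      k * (c - (∑ j, l j) / k) ^ 2 := by
    field_simp
    ring
  nlinarith [mul_nonneg hk0.le (sq_nonneg (c - (∑ j, l j) / k))]

theorem meanEig_lt (hk₁ : 1 ≤ k) (hk : k ≤ n) {A : Herm n} {c : ℝ}
    (h : ∀ j, lowEig hk A j < c) : meanEig hk A < c := by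
  have hk0 : (0 : ℝ) < k := by exact_mod_cast hk₁
  rw [meanEig, div_lt_iff₀ hk0]
  calc ∑ j, lowEig hk A j < ∑ _j : Fin k, c :=
        Finset.sum_lt_sum_of_nonempty ⟨⟨0, hk₁⟩, Finset.mem_univ _⟩ fun j _ => h j
    _ = c * k := by simp [mul_comm]

/-- Below the gap, the distance from `Σ_k` is `√k` times the standard deviation. -/
theorem infDist_degenerate (hk₁ : 1 ≤ k) (hk : k ≤ n) {A : Herm n}
    (hgap : ∀ i j : Fin n, (i : ℕ) < k → k ≤ (j : ℕ) → eig A i < eig A j) :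
    Metric.infDist A (degenerate n k) = Real.sqrt k * stdDev hk A := by
  rw [sqrt_mul_stdDev hk₁]
  obtain ⟨W, hW, hA⟩ := exists_eig_diagonalization A
  have hA' : A = ofDiagonalization W (eig A) := Subtype.ext hA
  -- The nearest degenerate matrix: keep the eigenvectors and collapse the low eigenvalues to their
  -- mean, which stays below the gap.
  set f : Fin n → ℝ := fun i => if (i : ℕ) < k then meanEig hk A else eig A i with hf
  have hlt (j : Fin n) (hj : k ≤ (j : ℕ)) : meanEig hk A < eig A j :=
    meanEig_lt hk₁ hk fun i => hgap _ _ i.2 hj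
  have hfm : Monotone f := by
    intro i j hij
    have hij' : (i : ℕ) ≤ j := hij
    simp only [hf]
    split_ifs with h1 h2 h2
    · exact le_rfl
    · exact (hlt j (by omega)).le
    · omega
    · exact eig_monotone A hij
  set G := ofDiagonalization W f
  have hG : G ∈ degenerate n k := by
    intro i j hi
    rw [eig_ofDiagonalization hW hfm]
    refine ⟨fun hj => by simp [hf, hi, hj], fun hj => ?_⟩
    simpa [hf, hi, hj.not_gt] using hlt j hj
  have hAG : ‖A - G‖ ^ 2 = ∑ j, (lowEig hk A j - meanEig hk A) ^ 2 := by
    rw [hA', norm_sq_sub_ofDiagonalization hW, ← hA']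
    simp only [lowEig]
    rw [sum_castLE hk fun i => (eig A i - meanEig hk A) ^ 2]
    refine Finset.sum_congr rfl fun i _ => ?_
    simp only [hf]
    split_ifs <;> simp
  apply le_antisymm
  · refine (Metric.infDist_le_dist_of_mem hG).trans_eq ?_
    rw [dist_eq_norm, ← hAG, Real.sqrt_sq (norm_nonneg _)]
  · refine (Metric.le_infDist ⟨G, hG⟩).2 fun B hB => ?_
    rw [dist_eq_norm, Real.sqrt_le_left (norm_nonneg _)]
    -- In the Hoffman–Wielandt sum discard the indices from `k` on; the low eigenvalues of `B` share
    -- one value, and the mean is the best such value.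
    refine le_trans ?_ (sum_sq_eig_sub_le A B)
    refine (sum_sq_sub_mean_le (lowEig hk A) (eig B (Fin.castLE hk ⟨0, hk₁⟩))).trans ?_
    have h1 : ∑ i, (lowEig hk A i - eig B (Fin.castLE hk ⟨0, hk₁⟩)) ^ 2 =
        ∑ i : Fin k, (fun i => (eig A i - eig B i) ^ 2) (Fin.castLE hk i) := by
      refine Finset.sum_congr rfl fun i _ => ?_
      rw [(hB (Fin.castLE hk ⟨0, hk₁⟩) (Fin.castLE hk i) hk₁).1 i.2]
      rfl
    rw [h1, sum_castLE hk fun i => (eig A i - eig B i) ^ 2]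
    refine Finset.sum_le_sum fun i _ => ?_
    split_ifs
    · exact le_rfl
    · positivity

/-! ### The spectral projection onto the lowest eigenvalues -/

theorem blockOne_mul_apply (X : Matrix (Fin n) (Fin n) ℂ) (i j : Fin n) :
    (blockOne n k * X) i j = if (i : ℕ) < k then X i j else 0 := by
  simp [blockOne, diagonal_mul]

theorem mul_blockOne_apply (X : Matrix (Fin n) (Fin n) ℂ) (i j : Fin n) :
    (X * blockOne n k) i j = if (j : ℕ) < k then X i j else 0 := by
  simp [blockOne, mul_diagonal]

theorem blockOne_mul_self : blockOne n k * blockOne n k = blockOne n k := by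
  ext i j
  rw [blockOne_mul_apply]
  split_ifs with h
  · rfl
  · simp [blockOne, diagonal_apply, h]

theorem star_blockOne : star (blockOne n k) = blockOne n k := by
  rw [star_eq_conjTranspose, blockOne, diagonal_conjTranspose]
  congr 1
  ext i
  simp only [Pi.star_apply]
  split_ifs <;> simp

theorem trace_blockOne_mul (hk : k ≤ n) (X : Matrix (Fin n) (Fin n) ℂ) :
    trace (blockOne n k * X) = ∑ i : Fin k, X (Fin.castLE hk i) (Fin.castLE hk i) := by
  rw [sum_castLE hk fun i => X i i]
  simp [trace, blockOne_mul_apply]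

theorem trace_conj_mul_conj {U : Matrix (Fin n) (Fin n) ℂ}
    (hU : U ∈ unitary (Matrix (Fin n) (Fin n) ℂ)) (X Y : Matrix (Fin n) (Fin n) ℂ) :
    trace ((U * X * star U) * (U * Y * star U)) = trace (X * Y) := by
  have h : (U * X * star U) * (U * Y * star U) = U * (X * Y * star U) := by
    simp only [mul_assoc]
    rw [← mul_assoc (star U) U, Unitary.star_mul_self_of_mem hU, one_mul]
  rw [h, trace_mul_comm, mul_assoc, Unitary.star_mul_self_of_mem hU, mul_one]

theorem conj_mul_conj {U : Matrix (Fin n) (Fin n) ℂ}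
    (hU : U ∈ unitary (Matrix (Fin n) (Fin n) ℂ)) (X Y : Matrix (Fin n) (Fin n) ℂ) :
    (U * X * star U) * (U * Y * star U) = U * (X * Y) * star U := by
  simp only [mul_assoc]
  rw [← mul_assoc (star U) U, Unitary.star_mul_self_of_mem hU, one_mul]

/-- Two unitary matrices, the first `k` columns of one lying in the span of the first `k` columns
of the other, define the same orthogonal projection. -/
theorem conj_blockOne_eq (hk : k ≤ n) {U W : Matrix (Fin n) (Fin n) ℂ}
    (hU : U ∈ unitary (Matrix (Fin n) (Fin n) ℂ)) (hW : W ∈ unitary (Matrix (Fin n) (Fin n) ℂ))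
    (h : ∀ j : Fin k, W.col (Fin.castLE hk j) ∈
      Submodule.span ℂ (Set.range fun j : Fin k => U.col (Fin.castLE hk j))) :
    U * blockOne n k * star U = W * blockOne n k * star W := by
  set P := U * blockOne n k * star U with hP
  set R := W * blockOne n k * star W with hR
  have hfixU : ∀ x ∈ Submodule.span ℂ (Set.range fun j : Fin k => U.col (Fin.castLE hk j)),
      P *ᵥ x = x := by
    intro x hx
    induction hx using Submodule.span_induction with
    | mem x hx =>
      obtain ⟨j, rfl⟩ := hx
      have h1 : P * U = U * blockOne n k := by
        rw [hP, mul_assoc, Unitary.star_mul_self_of_mem hU, mul_one]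
      ext i
      have h2 := congrArg (fun Y : Matrix (Fin n) (Fin n) ℂ => Y i (Fin.castLE hk j)) h1
      simp only [mul_blockOne_apply, Fin.val_castLE, j.2, if_true] at h2
      exact h2
    | zero => exact mulVec_zero _
    | add x y _ _ hx hy => rw [mulVec_add, hx, hy]
    | smul a x _ hx => rw [mulVec_smul, hx]
  have h1 : P * (W * blockOne n k) = W * blockOne n k := by
    rw [← mul_assoc]
    ext i j
    rw [mul_blockOne_apply, mul_blockOne_apply]
    split_ifs with hj
    · exact congrFun (hfixU _ (h ⟨j, hj⟩)) i
    · rfl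
  have hPR : P * R = R := by rw [hR, ← mul_assoc, h1]
  have hPs : star P = P := by
    simp only [hP, star_mul, star_star, star_blockOne, mul_assoc]
  have hRs : star R = R := by
    simp only [hR, star_mul, star_star, star_blockOne, mul_assoc]
  have hRP : R * P = R := by
    have := congrArg star hPR
    rwa [star_mul, hPs, hRs] at this
  have hPP : P * P = P := by rw [hP, conj_mul_conj hU, blockOne_mul_self]
  have hRR : R * R = R := by rw [hR, conj_mul_conj hW, blockOne_mul_self]
  -- So far `R` is a subprojection of `P`. Both traces equal that of `blockOne`, and `(P - R)² = P -
  -- R`, so the norm of `P - R` is zero.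
  have htr : trace P = trace R := by
    rw [← hPP, ← hRR, hP, hR, trace_conj_mul_conj hU, trace_conj_mul_conj hW]
  have h0 : ((‖P - R‖ ^ 2 : ℝ) : ℂ) = 0 := by
    rw [frobenius_norm_sq_eq_trace, star_sub, hPs, hRs, sub_mul, mul_sub, mul_sub, hPP, hPR, hRP,
      hRR, sub_self, sub_zero, trace_sub, htr, sub_self]
  have h2 : ‖P - R‖ = 0 := by simpa using h0
  exact sub_eq_zero.1 (norm_eq_zero.1 h2)

end SchriefferWolff

namespace SchriefferWolff

open Matrix

variable {n k : ℕ}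

/-! ### Algebra of the decomposition -/

theorem IsBasePoint.eig_eq {H₀ : Herm n} (h : IsBasePoint k H₀) (i : Fin n) :
    eig H₀ i = (H₀.mat i i).re := by
  refine congrFun (eig_eq_of_diagonalization (f := fun i => (H₀.mat i i).re) h.mono
    (one_mem _) ?_) i
  rw [star_one, one_mul, mul_one, ← h.diag.diagonal_diag]
  congr 1
  ext i
  simpa using (Complex.conj_eq_iff_re.1 (H₀.isHermitian.apply i i)).symm

theorem IsBasePoint.mat_eq {H₀ : Herm n} (h : IsBasePoint k H₀) :
    H₀.mat = diagonal fun i => (eig H₀ i : ℂ) := by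
  rw [← h.diag.diagonal_diag]
  congr 1
  ext i
  rw [h.eig_eq]
  simpa using (Complex.conj_eq_iff_re.1 (H₀.isHermitian.apply i i)).symm

/-- The block diagonal matrix `H₀ + B + T + H_eff`. -/
abbrev SWData.blockMat (H₀ : Herm n) (p : SWData n k) : Matrix (Fin n) (Fin n) ℂ :=
  H₀.mat + p.B + p.T + p.eff.1.mat

theorem SWData.exp_mem_unitary (p : SWData n k) :
    NormedSpace.exp (Complex.I • p.S) ∈ unitary (Matrix (Fin n) (Fin n) ℂ) := by
  refine NormedSpace.exp_mem_unitary_of_mem_skewAdjoint ?_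
  exact IsSelfAdjoint.smul_mem_skewAdjoint Complex.conj_I p.1.1.2

theorem SWData.star_exp (p : SWData n k) :
    star (NormedSpace.exp (Complex.I • p.S)) = NormedSpace.exp (-(Complex.I • p.S)) := by
  rw [NormedSpace.star_exp]
  congr 1
  exact skewAdjoint.mem_iff.1 (IsSelfAdjoint.smul_mem_skewAdjoint Complex.conj_I p.1.1.2)

theorem SWData.star_blockMat (H₀ : Herm n) (p : SWData n k) :
    star (p.blockMat H₀) = p.blockMat H₀ := by
  have h1 : star H₀.mat = H₀.mat := H₀.2
  have h2 : star p.B = p.B := p.2.1.1.2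
  have h3 : star p.eff.1.mat = p.eff.1.mat := p.eff.1.2
  have h4 : star p.T = p.T := by
    rw [star_smul, star_blockOne]
    simp
  rw [SWData.blockMat, star_add, star_add, star_add, h1, h2, h3, h4]

theorem SWData.blockOne_mul_B (p : SWData n k) : blockOne n k * p.B = 0 := by
  ext i j
  rw [blockOne_mul_apply]
  split_ifs with h
  · exact p.2.1.2 i j (Or.inl h)
  · rfl

theorem SWData.blockOne_mul_eff (p : SWData n k) :
    blockOne n k * p.eff.1.mat = p.eff.1.mat := by
  ext i j
  rw [blockOne_mul_apply]
  split_ifs with h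
  · rfl
  · exact (p.eff.2.1 i j (Or.inl (by omega))).symm

theorem SWData.eff_mul_blockOne (p : SWData n k) :
    p.eff.1.mat * blockOne n k = p.eff.1.mat := by
  ext i j
  rw [mul_blockOne_apply]
  split_ifs with h
  · rfl
  · exact (p.eff.2.1 i j (Or.inr (by omega))).symm

theorem IsBasePoint.blockOne_mul {H₀ : Herm n} (h : IsBasePoint k H₀) (i₀ : Fin n)
    (hi₀ : (i₀ : ℕ) < k) : blockOne n k * H₀.mat = (eig H₀ i₀ : ℂ) • blockOne n k := by
  ext i j
  rw [blockOne_mul_apply, h.mat_eq]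
  split_ifs with hi
  · by_cases hij : i = j
    · subst hij
      simp [blockOne, hi, (h.mem i₀ i hi₀).1 hi]
    · simp [blockOne, hij]
  · simp [blockOne, diagonal_apply, hi]

/-- The upper left block of `H₀ + B + T + H_eff` is a scalar plus `H_eff`. -/
theorem SWData.blockOne_mul_blockMat {H₀ : Herm n} (h : IsBasePoint k H₀) (i₀ : Fin n)
    (hi₀ : (i₀ : ℕ) < k) (p : SWData n k) :
    blockOne n k * p.blockMat H₀ =
      ((eig H₀ i₀ + p.2.2.1 : ℝ) : ℂ) • blockOne n k + p.eff.1.mat := by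
  rw [SWData.blockMat, mul_add, mul_add, mul_add, p.blockOne_mul_B, p.blockOne_mul_eff,
    h.blockOne_mul i₀ hi₀, SWData.T, Matrix.mul_smul, blockOne_mul_self, add_zero, ← add_smul,
    Complex.ofReal_add]

/-- The norm of the effective Hamiltonian is `√k` times the standard deviation of the `k` lowest
eigenvalues. -/
theorem IsSWDecomposition.norm_eff (hk₁ : 1 ≤ k) {hk : k ≤ n} {H₀ H : Herm n}
    (hH₀ : IsBasePoint k H₀) {p : SWData n k} (h : IsSWDecomposition hk H₀ H p) :
    ‖p.eff‖ = Real.sqrt k * stdDev hk H := by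
  obtain ⟨W, hW, hHW⟩ := exists_eig_diagonalization H
  set U := NormedSpace.exp (Complex.I • p.S) with hUdef
  have hU : U ∈ unitary (Matrix (Fin n) (Fin n) ℂ) := p.exp_mem_unitary
  have hHU : H.mat = U * p.blockMat H₀ * star U := by
    rw [h.eq, p.star_exp]
  have hcol (j : Fin k) : W.col (Fin.castLE hk j) ∈
      Submodule.span ℂ (Set.range fun j : Fin k => U.col (Fin.castLE hk j)) := by
    rw [h.lowest]
    refine Submodule.mem_iSup_of_mem j ?_
    rw [Module.End.mem_eigenspace_iff, toLin'_apply]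
    have h1 : H.mat * W = W * diagonal (fun i => (eig H i : ℂ)) := by
      conv_lhs => rw [hHW]
      rw [mul_assoc, Unitary.star_mul_self_of_mem hW, mul_one]
    ext i
    have h2 := congrArg (fun Y : Matrix (Fin n) (Fin n) ℂ => Y i (Fin.castLE hk j)) h1
    simp only [mul_diagonal] at h2
    rw [mul_comm] at h2
    exact h2
  -- The spectral projection onto the low eigenvalues, seen in the frame `U` and in the eigenframe
  -- `W`.
  have hPR := conj_blockOne_eq hk hU hW hcol
  set i₀ : Fin n := Fin.castLE hk ⟨0, hk₁⟩
  have hi₀ : (i₀ : ℕ) < k := hk₁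
  set μ : ℝ := eig H₀ i₀ + p.2.2.1
  set E := p.eff.1.mat
  have hk0 : (0 : ℝ) < k := by exact_mod_cast hk₁
  -- Compute `tr (P H)` in both frames: since `H_eff` is traceless it is `k μ` in one, and the sum
  -- of the low eigenvalues in the other.
  have hmean : meanEig hk H = μ := by
    have h1 : trace (blockOne n k * p.blockMat H₀) =
        trace (blockOne n k * diagonal (fun i => (eig H i : ℂ))) := by
      rw [← trace_conj_mul_conj hU, ← hHU, hPR,
        ← trace_conj_mul_conj hW _ (diagonal fun i => (eig H i : ℂ)), ← hHW]
    have h2 : trace (blockOne n k) = k := by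
      have := trace_blockOne_mul hk (1 : Matrix (Fin n) (Fin n) ℂ)
      rw [mul_one] at this
      simp [this]
    rw [p.blockOne_mul_blockMat hH₀ i₀ hi₀, trace_add, trace_smul, h2, p.eff.2.2, add_zero,
      trace_blockOne_mul hk] at h1
    simp only [diagonal_apply_eq, smul_eq_mul] at h1
    rw [meanEig, div_eq_iff hk0.ne']
    exact_mod_cast h1.symm
  have hshift (V X : Matrix (Fin n) (Fin n) ℂ) (hV : V ∈ unitary (Matrix (Fin n) (Fin n) ℂ))
      (hX : H.mat = V * X * star V) :
      H.mat - (μ : ℂ) • 1 = V * (X - (μ : ℂ) • 1) * star V := by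
    rw [mul_sub, sub_mul, ← hX, Matrix.mul_smul, mul_one, Matrix.smul_mul,
      Unitary.mul_star_self_of_mem hV]
  -- The same comparison for `tr (P (H - μ)²)`: one frame gives `‖H_eff‖²`, the other the sum of
  -- squared deviations.
  have hsq : trace (blockOne n k *
        ((p.blockMat H₀ - (μ : ℂ) • 1) * (p.blockMat H₀ - (μ : ℂ) • 1))) =
      trace (blockOne n k * ((diagonal (fun i => (eig H i : ℂ)) - (μ : ℂ) • 1) *
        (diagonal (fun i => (eig H i : ℂ)) - (μ : ℂ) • 1))) := by
    rw [← trace_conj_mul_conj hU, ← conj_mul_conj hU _ (p.blockMat H₀ - (μ : ℂ) • 1),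
      ← hshift U _ hU hHU, hPR, ← trace_conj_mul_conj hW (blockOne n k) (_ * _),
      ← conj_mul_conj hW _ (diagonal (fun i => (eig H i : ℂ)) - (μ : ℂ) • 1),
      ← hshift W _ hW hHW]
  have hQ : blockOne n k * (p.blockMat H₀ - (μ : ℂ) • 1) = E := by
    rw [mul_sub, p.blockOne_mul_blockMat hH₀ i₀ hi₀, Matrix.mul_smul, mul_one,
      add_sub_cancel_left]
  have hQ2 : blockOne n k *
      ((p.blockMat H₀ - (μ : ℂ) • 1) * (p.blockMat H₀ - (μ : ℂ) • 1)) = star E * E := by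
    have hE : star E = E := p.eff.1.2
    rw [← mul_assoc, hQ, hE]
    nth_rw 1 [show E = E * blockOne n k from p.eff_mul_blockOne.symm]
    rw [mul_assoc, hQ]
  have hdiag : diagonal (fun i => (eig H i : ℂ)) - (μ : ℂ) • (1 : Matrix (Fin n) (Fin n) ℂ) =
      diagonal fun i => ((eig H i - μ : ℝ) : ℂ) := by
    rw [smul_one_eq_diagonal, diagonal_sub]
    simp
  rw [hQ2, ← frobenius_norm_sq_eq_trace, hdiag, diagonal_mul_diagonal,
    trace_blockOne_mul hk] at hsq
  simp only [diagonal_apply_eq] at hsq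
  have hnorm : ‖p.eff‖ ^ 2 = ∑ j, (lowEig hk H j - meanEig hk H) ^ 2 := by
    rw [hmean]
    have : ‖E‖ ^ 2 = ∑ j : Fin k, (eig H (Fin.castLE hk j) - μ) *
      (eig H (Fin.castLE hk j) - μ) := by exact_mod_cast hsq
    simp only [← sq] at this
    exact this
  rw [sqrt_mul_stdDev hk₁, ← hnorm]
  exact (Real.sqrt_sq (norm_nonneg p.eff)).symm

end SchriefferWolff

namespace SchriefferWolff

open Matrix

variable {n k m : ℕ}

/-! ### Block diagonal Hermitian matrices -/

/-- The block diagonal matrix with diagonal blocks `A` and `D`. -/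
def blockDiag (A : Matrix (Fin k) (Fin k) ℂ) (D : Matrix (Fin m) (Fin m) ℂ) :
    Matrix (Fin (k + m)) (Fin (k + m)) ℂ :=
  (fromBlocks A 0 0 D).submatrix finSumFinEquiv.symm finSumFinEquiv.symm

theorem blockDiag_mul (A A' : Matrix (Fin k) (Fin k) ℂ) (D D' : Matrix (Fin m) (Fin m) ℂ) :
    blockDiag A D * blockDiag A' D' = blockDiag (A * A') (D * D') := by
  rw [blockDiag, blockDiag, submatrix_mul_equiv, fromBlocks_multiply]
  simp [blockDiag]

theorem star_blockDiag (A : Matrix (Fin k) (Fin k) ℂ) (D : Matrix (Fin m) (Fin m) ℂ) :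
    star (blockDiag A D) = blockDiag (star A) (star D) := by
  rw [blockDiag, star_eq_conjTranspose, conjTranspose_submatrix, fromBlocks_conjTranspose]
  simp [blockDiag, star_eq_conjTranspose]

theorem blockDiag_one : blockDiag (1 : Matrix (Fin k) (Fin k) ℂ) (1 : Matrix (Fin m) (Fin m) ℂ) =
    1 := by
  rw [blockDiag, fromBlocks_one, submatrix_one_equiv]

theorem blockDiag_mem_unitary {A : Matrix (Fin k) (Fin k) ℂ} {D : Matrix (Fin m) (Fin m) ℂ}
    (hA : A ∈ unitary (Matrix (Fin k) (Fin k) ℂ)) (hD : D ∈ unitary (Matrix (Fin m) (Fin m) ℂ)) :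
    blockDiag A D ∈ unitary (Matrix (Fin (k + m)) (Fin (k + m)) ℂ) := by
  rw [Unitary.mem_iff, star_blockDiag, blockDiag_mul, blockDiag_mul,
    Unitary.star_mul_self_of_mem hA, Unitary.star_mul_self_of_mem hD,
    Unitary.mul_star_self_of_mem hA, Unitary.mul_star_self_of_mem hD, blockDiag_one]
  exact ⟨rfl, rfl⟩

theorem blockOne_eq_blockDiag : blockOne (k + m) k = blockDiag 1 0 := by
  ext i j
  induction i using Fin.addCases <;> induction j using Fin.addCases <;>
    simp [blockOne, blockDiag, diagonal_apply, one_apply, Fin.ext_iff]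
  all_goals omega

theorem diagonal_append_eq_blockDiag (a : Fin k → ℝ) (b : Fin m → ℝ) :
    diagonal (fun i => ((Fin.append a b i : ℝ) : ℂ)) =
      blockDiag (diagonal fun i => (a i : ℂ)) (diagonal fun i => (b i : ℂ)) := by
  ext i j
  induction i using Fin.addCases <;> induction j using Fin.addCases <;>
    simp [blockDiag, diagonal_apply, Fin.ext_iff]
  all_goals omega

/-- The upper left block of a Hermitian matrix. -/
def upperBlock (k m : ℕ) : Herm (k + m) →ₗ[ℝ] Herm k where
  toFun X := ⟨X.mat.submatrix (Fin.castAdd m) (Fin.castAdd m), X.isHermitian.submatrix _⟩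
  map_add' _ _ := rfl
  map_smul' _ _ := rfl

/-- The lower right block of a Hermitian matrix. -/
def lowerRightBlock (k m : ℕ) : Herm (k + m) →ₗ[ℝ] Herm m where
  toFun X := ⟨X.mat.submatrix (Fin.natAdd k) (Fin.natAdd k), X.isHermitian.submatrix _⟩
  map_add' _ _ := rfl
  map_smul' _ _ := rfl

/-- Diagonalize the two blocks separately. Commutation with `blockOne` records that the
diagonalizing unitary does not mix them. -/
theorem exists_block_diagonalization (X : Herm (k + m))
    (hX : ∀ i j, X.mat (Fin.castAdd m i) (Fin.natAdd k j) = 0) :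
    ∃ W ∈ unitary (Matrix (Fin (k + m)) (Fin (k + m)) ℂ),
      W * blockOne (k + m) k = blockOne (k + m) k * W ∧
      X.mat = W * diagonal (fun i => ((Fin.append (eig (upperBlock k m X))
        (eig (lowerRightBlock k m X)) i : ℝ) : ℂ)) * star W := by
  obtain ⟨W₁, hW₁, h₁⟩ := exists_eig_diagonalization (upperBlock k m X)
  obtain ⟨W₂, hW₂, h₂⟩ := exists_eig_diagonalization (lowerRightBlock k m X)
  have hX' : X.mat = blockDiag (upperBlock k m X).mat (lowerRightBlock k m X).mat := by
    have hX2 (i j) : X.mat (Fin.natAdd k i) (Fin.castAdd m j) = 0 := by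
      rw [← X.isHermitian.apply, hX, star_zero]
    ext i j
    induction i using Fin.addCases <;> induction j using Fin.addCases <;>
      simp [blockDiag, hX, hX2]
    all_goals rfl
  refine ⟨blockDiag W₁ W₂, blockDiag_mem_unitary hW₁ hW₂, ?_, ?_⟩
  · rw [blockOne_eq_blockDiag, blockDiag_mul, blockDiag_mul]
    simp
  · rw [diagonal_append_eq_blockDiag, star_blockDiag, blockDiag_mul, blockDiag_mul, ← h₁, ← h₂]
    exact hX'

theorem monotone_append {a : Fin k → ℝ} {b : Fin m → ℝ} (ha : Monotone a) (hb : Monotone b)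
    (h : ∀ i j, a i ≤ b j) : Monotone (Fin.append a b) := by
  intro i j hij
  induction i using Fin.addCases with
  | left i =>
    induction j using Fin.addCases with
    | left j => simpa using ha (show (i : ℕ) ≤ j from hij)
    | right j => simpa using h i j
  | right i =>
    induction j using Fin.addCases with
    | left j =>
      rw [Fin.le_def] at hij
      simp at hij
      omega
    | right j => simpa using hb (by simpa using hij)

/-! ### The span of the first columns -/

theorem span_col_castLE (hk : k ≤ n) (V : Matrix (Fin n) (Fin n) ℂ) :
    Submodule.span ℂ (Set.range fun j : Fin k => V.col (Fin.castLE hk j)) =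
      LinearMap.range (V * blockOne n k).mulVecLin := by
  rw [range_mulVecLin]
  have h (j : Fin n) : (V * blockOne n k).col j = if (j : ℕ) < k then V.col j else 0 := by
    ext i
    rw [col_apply, mul_blockOne_apply]
    split_ifs <;> rfl
  apply le_antisymm
  · rw [Submodule.span_le]
    rintro _ ⟨j, rfl⟩
    refine Submodule.subset_span ⟨Fin.castLE hk j, ?_⟩
    rw [h]
    simp
  · rw [Submodule.span_le]
    rintro _ ⟨j, rfl⟩
    rw [h]
    split_ifs with hj
    · exact Submodule.subset_span ⟨⟨j, hj⟩, rfl⟩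
    · exact Submodule.zero_mem _

/-- The span is the range of `U W P = U P W` with `P = blockOne`, and `W` is surjective. -/
theorem span_col_mul_unitary (hk : k ≤ n) {U W : Matrix (Fin n) (Fin n) ℂ}
    (hW : W ∈ unitary (Matrix (Fin n) (Fin n) ℂ))
    (hc : W * blockOne n k = blockOne n k * W) :
    Submodule.span ℂ (Set.range fun j : Fin k => (U * W).col (Fin.castLE hk j)) =
      Submodule.span ℂ (Set.range fun j : Fin k => U.col (Fin.castLE hk j)) := by
  rw [span_col_castLE, span_col_castLE, mul_assoc, hc, ← mul_assoc, mulVecLin_mul]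
  refine LinearMap.range_comp_of_range_eq_top _ (LinearMap.range_eq_top.2 fun x => ?_)
  refine ⟨star W *ᵥ x, ?_⟩
  rw [mulVecLin_apply, mulVec_mulVec, Unitary.mul_star_self_of_mem hW, one_mulVec]

/-- If the diagonal entries of a diagonalization have a gap at `k`, the first `k` columns span the
sum of the corresponding eigenspaces. -/
theorem span_col_eq_iSup_eigenspace (hk : k ≤ n) {A U : Matrix (Fin n) (Fin n) ℂ} {f : Fin n → ℝ}
    (hU : U ∈ unitary (Matrix (Fin n) (Fin n) ℂ))
    (hA : A = U * diagonal (fun i => (f i : ℂ)) * star U)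
    (hgap : ∀ i j : Fin n, (i : ℕ) < k → k ≤ (j : ℕ) → f i < f j) :
    Submodule.span ℂ (Set.range fun j : Fin k => U.col (Fin.castLE hk j)) =
      ⨆ j : Fin k, Module.End.eigenspace (Matrix.toLin' A) (f (Fin.castLE hk j) : ℂ) := by
  apply le_antisymm
  · rw [Submodule.span_le]
    rintro _ ⟨j, rfl⟩
    refine Submodule.mem_iSup_of_mem j ?_
    rw [Module.End.mem_eigenspace_iff, toLin'_apply]
    have h1 : A * U = U * diagonal (fun i => (f i : ℂ)) := by
      rw [hA, mul_assoc, Unitary.star_mul_self_of_mem hU, mul_one]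
    ext i
    have h2 := congrArg (fun Y : Matrix (Fin n) (Fin n) ℂ => Y i (Fin.castLE hk j)) h1
    simp only [mul_diagonal] at h2
    rw [mul_comm] at h2
    exact h2
  · refine iSup_le fun j v hv => ?_
    rw [Module.End.mem_eigenspace_iff, toLin'_apply] at hv
    set w := star U *ᵥ v with hw
    have hvw : v = U *ᵥ w := by
      rw [hw, mulVec_mulVec, Unitary.mul_star_self_of_mem hU, one_mulVec]
    have h1 : diagonal (fun i => (f i : ℂ)) *ᵥ w = (f (Fin.castLE hk j) : ℂ) • w := by
      rw [hw, ← mulVec_smul, ← hv, hA, mulVec_mulVec, mulVec_mulVec, mul_assoc U, ← mul_assoc,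
        Unitary.star_mul_self_of_mem hU, one_mul]
    -- In eigencoordinates an eigenvector has no component at a different eigenvalue, and the gap
    -- makes all upper eigenvalues different.
    have h2 (i : Fin n) (hi : k ≤ (i : ℕ)) : w i = 0 := by
      have h3 := congrFun h1 i
      rw [mulVec_diagonal, Pi.smul_apply, smul_eq_mul] at h3
      have h4 : (f (Fin.castLE hk j) : ℂ) ≠ f i := by
        exact_mod_cast (hgap (Fin.castLE hk j) i j.2 hi).ne
      by_contra h0
      exact h4 (mul_right_cancel₀ h0 h3).symm
    rw [span_col_castLE, hvw]
    refine ⟨w, ?_⟩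
    rw [mulVecLin_apply, ← mulVec_mulVec]
    congr 1
    ext i
    rw [blockOne, mulVec_diagonal]
    split_ifs with hi
    · rw [one_mul]
    · rw [zero_mul, h2 i (by omega)]

end SchriefferWolff

namespace SchriefferWolff

open Matrix

variable {n k m : ℕ}

/-! ### The decomposition as a local analytic diffeomorphism -/

/-- Local analytic invertibility at `0` of `p ↦ ρ (e^{L p} (a + N p) e^{-L p})`, for linear maps
`L`, `N`, `ρ`, when the derivative is bijective. -/
theorem exists_openPartialHomeomorph_exp_conj {E F A : Type*}
    [NormedAddCommGroup E] [NormedSpace ℝ E] [FiniteDimensional ℝ E]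
    [NormedAddCommGroup F] [NormedSpace ℝ F] [FiniteDimensional ℝ F]
    [NormedRing A] [NormedAlgebra ℝ A] [FiniteDimensional ℝ A]
    (L N : E →ₗ[ℝ] A) (ρ : A →ₗ[ℝ] F) (a : A)
    (h : Function.Bijective fun p => ρ (L p * a + N p - a * L p)) :
    ∃ Φ : OpenPartialHomeomorph E F, 0 ∈ Φ.source ∧
      (∀ p, Φ p = ρ (NormedSpace.exp (L p) * (a + N p) * NormedSpace.exp (-L p))) ∧
      AnalyticAt ℝ Φ.symm (ρ a) := by
  have := FiniteDimensional.complete ℝ E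
  have := FiniteDimensional.complete ℝ F
  have := FiniteDimensional.complete ℝ A
  set L' := L.toContinuousLinearMap
  set N' := N.toContinuousLinearMap
  set ρ' := ρ.toContinuousLinearMap
  set f : E → F := fun p => ρ' (NormedSpace.exp (L' p) * (a + N' p) * NormedSpace.exp (-L' p))
  have hf0 : f 0 = ρ a := by
    simp only [f, map_zero, neg_zero, NormedSpace.exp_zero, one_mul, mul_one, add_zero]
    rfl
  have han : AnalyticAt ℝ f 0 := by
    have h1 : AnalyticAt ℝ (fun p => NormedSpace.exp (L' p)) 0 :=
      (NormedSpace.exp_analytic (𝕂 := ℝ) _).fun_comp (L'.analyticAt 0)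
    have h2 : AnalyticAt ℝ (fun p => NormedSpace.exp (-L' p)) 0 :=
      (NormedSpace.exp_analytic (𝕂 := ℝ) _).fun_comp (L'.analyticAt 0).fun_neg
    exact (ρ'.analyticAt _).fun_comp
      ((h1.fun_mul (analyticAt_const.fun_add (N'.analyticAt 0))).fun_mul h2)
  -- Since `exp` has derivative the identity at `0`, the noncommutative product rule leaves the
  -- commutator of `L p` with `a`, plus `N p`.
  have hderiv : HasStrictFDerivAt f (ρ' ∘L ((ContinuousLinearMap.mul ℝ A).flip a ∘L L' + N' -
      ContinuousLinearMap.mul ℝ A a ∘L L')) 0 := by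
    have hexp : HasStrictFDerivAt (NormedSpace.exp : A → A) (1 : A →L[ℝ] A) 0 :=
      hasStrictFDerivAt_exp_zero
    have h1 : HasStrictFDerivAt (fun p => NormedSpace.exp (L' p)) L' 0 :=
      HasStrictFDerivAt.comp (0 : E) (f := L') (by rw [map_zero]; exact hexp)
        L'.hasStrictFDerivAt
    have h2 : HasStrictFDerivAt (fun p => NormedSpace.exp (-L' p)) (-L') 0 :=
      HasStrictFDerivAt.comp (0 : E) (f := fun p => -L' p)
        (by rw [map_zero, neg_zero]; exact hexp) L'.hasStrictFDerivAt.fun_neg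
    have h3 : HasStrictFDerivAt (fun p => a + N' p) N' 0 := N'.hasStrictFDerivAt.const_add _
    refine (ρ'.hasStrictFDerivAt.comp (0 : E) ((h1.mul' h3).mul' h2)).congr_fderiv ?_
    ext1 p
    simp only [ContinuousLinearMap.comp_apply]
    congr 1
    simp [NormedSpace.exp_zero]
    abel
  set D : E →ₗ[ℝ] F := ((ρ' ∘L ((ContinuousLinearMap.mul ℝ A).flip a ∘L L' + N' -
      ContinuousLinearMap.mul ℝ A a ∘L L') : E →L[ℝ] F) : E →ₗ[ℝ] F) with hD
  have hDbij : Function.Bijective D := h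
  set e : E ≃L[ℝ] F := (LinearEquiv.ofBijective D hDbij).toContinuousLinearEquiv
  have hderiv' : HasStrictFDerivAt f (e : E →L[ℝ] F) 0 := hderiv.congr_fderiv (by ext p; rfl)
  refine ⟨hderiv'.toOpenPartialHomeomorph f, hderiv'.mem_toOpenPartialHomeomorph_source,
    fun p => rfl, ?_⟩
  rw [← hf0]
  exact (hderiv'.toOpenPartialHomeomorph f).analyticAt_symm'
    hderiv'.mem_toOpenPartialHomeomorph_source han hderiv'.hasFDerivAt.fderiv

noncomputable section

/-- The Hermitian part of a matrix. -/
def hermPart (n : ℕ) : Matrix (Fin n) (Fin n) ℂ →ₗ[ℝ] Herm n where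
  toFun X := ⟨(1 / 2 : ℝ) • (X + star X), by
    change star _ = _
    rw [star_smul, star_add, star_star, add_comm]
    simp⟩
  map_add' X Y := Subtype.ext (by
    change (1 / 2 : ℝ) • (X + Y + star (X + Y)) =
      (1 / 2 : ℝ) • (X + star X) + (1 / 2 : ℝ) • (Y + star Y)
    rw [star_add, ← smul_add]
    congr 1
    abel)
  map_smul' c X := Subtype.ext (by
    change (1 / 2 : ℝ) • (c • X + star (c • X)) = c • ((1 / 2 : ℝ) • (X + star X))
    rw [star_smul, star_trivial, ← smul_add, smul_comm])

theorem hermPart_of_star_eq {X : Matrix (Fin n) (Fin n) ℂ} (hX : star X = X) :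
    (hermPart n X).mat = X := by
  change (1 / 2 : ℝ) • (X + star X) = X
  rw [hX, ← two_smul ℝ X, smul_smul]
  norm_num

/-- The Hermitian matrix `H₀ + B + T + H_eff`. -/
def SWData.blockHerm (H₀ : Herm n) (p : SWData n k) : Herm n :=
  ⟨p.blockMat H₀, p.star_blockMat H₀⟩

/-- The Hermitian matrix with Schrieffer–Wolff data `p`. -/
def SWData.toHerm (H₀ : Herm n) (p : SWData n k) : Herm n :=
  ⟨NormedSpace.exp (Complex.I • p.S) * p.blockMat H₀ * NormedSpace.exp (-(Complex.I • p.S)), by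
    rw [← p.star_exp]
    exact IsSelfAdjoint.conjugate (p.star_blockMat H₀) _⟩

/-- The exponent `iS` as a linear function of the data. -/
def swExponent (n k : ℕ) : SWData n k →ₗ[ℝ] Matrix (Fin n) (Fin n) ℂ where
  toFun p := Complex.I • p.S
  map_add' _ _ := smul_add _ _ _
  map_smul' _ _ := smul_comm _ _ _

/-- The perturbation `B + T + H_eff` as a linear function of the data. -/
def swBlock (n k : ℕ) : SWData n k →ₗ[ℝ] Matrix (Fin n) (Fin n) ℂ where
  toFun p := p.B + p.T + p.eff.1.mat
  map_add' p q := by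
    change p.B + q.B + ((p.2.2.1 + q.2.2.1 : ℝ) : ℂ) • blockOne n k +
      (p.eff.1.mat + q.eff.1.mat) = _
    rw [Complex.ofReal_add, add_smul]
    abel
  map_smul' c p := by
    change c • p.B + ((c * p.2.2.1 : ℝ) : ℂ) • blockOne n k + c • p.eff.1.mat =
      c • (p.B + p.T + p.eff.1.mat)
    rw [Complex.ofReal_mul, mul_smul, smul_add, smul_add]
    rfl

/-- Exponentials live in the matrix algebra, while the inverse function theorem needs `Herm n` as
target; the linear retraction `hermPart` reconciles the two. -/
theorem toHerm_eq_hermPart (H₀ : Herm n) (p : SWData n k) : p.toHerm H₀ =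
    hermPart n (NormedSpace.exp (swExponent n k p) * (H₀.mat + swBlock n k p) *
      NormedSpace.exp (-swExponent n k p)) := by
  apply Subtype.ext
  have h1 : NormedSpace.exp (swExponent n k p) * (H₀.mat + swBlock n k p) *
      NormedSpace.exp (-swExponent n k p) = (p.toHerm H₀).mat := by
    change NormedSpace.exp (Complex.I • p.S) * (H₀.mat + (p.B + p.T + p.eff.1.mat)) *
      NormedSpace.exp (-(Complex.I • p.S)) = _
    rw [← add_assoc, ← add_assoc]
    rfl
  rw [h1]
  exact (hermPart_of_star_eq (p.toHerm H₀).2).symm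

/-- The derivative at `0` of the decomposition map, entry by entry. -/
theorem swDeriv_apply {H₀ : Herm n} (h : IsBasePoint k H₀) (p : SWData n k) (i j : Fin n) :
    (hermPart n (swExponent n k p * H₀.mat + swBlock n k p - H₀.mat * swExponent n k p)).mat i j =
      Complex.I * p.S i j * (eig H₀ j - eig H₀ i : ℝ) +
        (p.B i j + p.2.2.1 * blockOne n k i j + p.eff.1.mat i j) := by
  have h1 : star (swExponent n k p * H₀.mat + swBlock n k p - H₀.mat * swExponent n k p) =
      swExponent n k p * H₀.mat + swBlock n k p - H₀.mat * swExponent n k p := by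
    have hS : star (swExponent n k p) = - swExponent n k p :=
      skewAdjoint.mem_iff.1 (IsSelfAdjoint.smul_mem_skewAdjoint Complex.conj_I p.1.1.2)
    have hH : star H₀.mat = H₀.mat := H₀.2
    have hB : star (swBlock n k p) = swBlock n k p := by
      have h2 := p.star_blockMat H₀
      have h3 : p.blockMat H₀ = H₀.mat + swBlock n k p := by
        change _ = H₀.mat + (p.B + p.T + p.eff.1.mat)
        rw [← add_assoc, ← add_assoc]
      rw [h3, star_add, hH] at h2
      exact add_left_cancel h2
    rw [star_sub, star_add, star_mul, star_mul, hS, hH, hB, mul_neg, neg_mul]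
    abel
  rw [hermPart_of_star_eq h1, h.mat_eq, Matrix.sub_apply, Matrix.add_apply, mul_diagonal,
    diagonal_mul]
  change Complex.I * p.S i j * _ + (p.B i j + p.2.2.1 * blockOne n k i j + p.eff.1.mat i j) -
    _ * (Complex.I * p.S i j) = _
  push_cast
  ring

end

end SchriefferWolff

namespace SchriefferWolff

open Matrix

variable {n k m : ℕ}

noncomputable section

/-! ### Bijectivity of the derivative at the base point -/

theorem IsBasePoint.eig_ne {H₀ : Herm n} (h : IsBasePoint k H₀) {i j : Fin n}
    (hij : ¬ ((i : ℕ) < k ↔ (j : ℕ) < k)) : eig H₀ j - eig H₀ i ≠ 0 := by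
  by_cases hi : (i : ℕ) < k
  · have := (h.mem i j hi).2 (not_lt.1 fun hj => hij (iff_of_true hi hj))
    exact (sub_pos.2 this).ne'
  · have := (h.mem j i (by tauto)).2 (by omega)
    exact (sub_neg.2 this).ne

theorem blockOne_apply_of_not_iff {i j : Fin n} (hij : ¬ ((i : ℕ) < k ↔ (j : ℕ) < k)) :
    blockOne n k i j = 0 := by
  rw [blockOne, diagonal_apply_ne]
  rintro rfl
  exact hij Iff.rfl

theorem swDeriv_apply_off {H₀ : Herm n} (h : IsBasePoint k H₀) (p : SWData n k) {i j : Fin n}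
    (hij : ¬ ((i : ℕ) < k ↔ (j : ℕ) < k)) :
    (hermPart n (swExponent n k p * H₀.mat + swBlock n k p - H₀.mat * swExponent n k p)).mat i j =
      Complex.I * p.S i j * (eig H₀ j - eig H₀ i : ℝ) := by
  have hB : p.B i j = 0 := p.2.1.2 i j (by tauto)
  have hE : p.eff.1.mat i j = 0 := p.eff.2.1 i j (by by_contra hc; push Not at hc; tauto)
  rw [swDeriv_apply h, blockOne_apply_of_not_iff hij, hB, hE]
  simp

theorem swDeriv_apply_lower {H₀ : Herm n} (h : IsBasePoint k H₀) (p : SWData n k) {i j : Fin n}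
    (hi : k ≤ (i : ℕ)) (hj : k ≤ (j : ℕ)) :
    (hermPart n (swExponent n k p * H₀.mat + swBlock n k p - H₀.mat * swExponent n k p)).mat i j =
      p.B i j := by
  have hS : p.S i j = 0 := p.1.2 i j (by omega)
  have hE : p.eff.1.mat i j = 0 := p.eff.2.1 i j (Or.inl hi)
  rw [swDeriv_apply h, hS, hE, blockOne, diagonal_apply]
  simp [hi.not_gt]

theorem swDeriv_apply_upper {H₀ : Herm n} (h : IsBasePoint k H₀) (p : SWData n k) {i j : Fin n}
    (hi : (i : ℕ) < k) (hj : (j : ℕ) < k) :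
    (hermPart n (swExponent n k p * H₀.mat + swBlock n k p - H₀.mat * swExponent n k p)).mat i j =
      (if i = j then (p.2.2.1 : ℂ) else 0) + p.eff.1.mat i j := by
  have hS : p.S i j = 0 := p.1.2 i j (by omega)
  have hB : p.B i j = 0 := p.2.1.2 i j (Or.inl hi)
  rw [swDeriv_apply h, hS, hB, blockOne, diagonal_apply]
  simp [hi]

theorem trace_hermZero (hk : k ≤ n) (E : hermZero n k) :
    ∑ i : Fin k, E.1.mat (Fin.castLE hk i) (Fin.castLE hk i) = 0 := by
  rw [sum_castLE hk fun i => E.1.mat i i]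
  refine Eq.trans ?_ E.2.2
  refine Finset.sum_congr rfl fun i _ => ?_
  split_ifs with hi
  · rfl
  · exact (E.2.1 i i (Or.inl (by omega))).symm

/-- The unknowns decouple: off-block entries give `S` after division by nonzero gaps, the lower
block is `B`, the trace of the upper block gives `c`, and the rest is `H_eff`. -/
theorem swDeriv_injective (hk₁ : 1 ≤ k) (hk : k ≤ n) {H₀ : Herm n} (h : IsBasePoint k H₀) :
    Function.Injective fun p : SWData n k =>
      hermPart n (swExponent n k p * H₀.mat + swBlock n k p - H₀.mat * swExponent n k p) := by
  intro p q hpq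
  have hent (i j : Fin n) := congrArg (fun X : Herm n => X.mat i j) hpq
  have hS : p.1 = q.1 := by
    apply Subtype.ext
    apply Subtype.ext
    ext i j
    by_cases hij : ((i : ℕ) < k ↔ (j : ℕ) < k)
    · exact (p.1.2 i j hij).trans (q.1.2 i j hij).symm
    · have h1 := hent i j
      simp only [swDeriv_apply_off h _ hij] at h1
      have h2 : ((eig H₀ j - eig H₀ i : ℝ) : ℂ) ≠ 0 := by exact_mod_cast h.eig_ne hij
      exact mul_left_cancel₀ Complex.I_ne_zero (mul_right_cancel₀ h2 h1)
  have hB : p.2.1 = q.2.1 := by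
    apply Subtype.ext
    apply Subtype.ext
    ext i j
    by_cases hij : (i : ℕ) < k ∨ (j : ℕ) < k
    · exact (p.2.1.2 i j hij).trans (q.2.1.2 i j hij).symm
    · push Not at hij
      have h1 := hent i j
      simp only [swDeriv_apply_lower h _ hij.1 hij.2] at h1
      exact h1
  have hc : p.2.2.1 = q.2.2.1 := by
    have h1 : ∑ i : Fin k, ((p.2.2.1 : ℂ) + p.eff.1.mat (Fin.castLE hk i) (Fin.castLE hk i)) =
        ∑ i : Fin k, ((q.2.2.1 : ℂ) + q.eff.1.mat (Fin.castLE hk i) (Fin.castLE hk i)) := by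
      refine Finset.sum_congr rfl fun i _ => ?_
      have h1 := hent (Fin.castLE hk i) (Fin.castLE hk i)
      have hi : ((Fin.castLE hk i : Fin n) : ℕ) < k := i.2
      simpa only [swDeriv_apply_upper h _ hi hi, if_true] using h1
    rw [Finset.sum_add_distrib, Finset.sum_add_distrib, trace_hermZero, trace_hermZero] at h1
    have hk0 : k ≠ 0 := by omega
    simpa [hk0] using h1
  have hE : p.2.2.2 = q.2.2.2 := by
    apply Subtype.ext
    apply Subtype.ext
    ext i j
    by_cases hij : k ≤ (i : ℕ) ∨ k ≤ (j : ℕ)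
    · exact (p.2.2.2.2.1 i j hij).trans (q.2.2.2.2.1 i j hij).symm
    · push Not at hij
      have h1 := hent i j
      simp only [swDeriv_apply_upper h _ hij.1 hij.2, hc] at h1
      exact add_left_cancel h1
  exact Prod.ext hS (Prod.ext hB (Prod.ext hc hE))

theorem swDeriv_surjective (hk₁ : 1 ≤ k) (hk : k ≤ n) {H₀ : Herm n} (h : IsBasePoint k H₀) :
    Function.Surjective fun p : SWData n k =>
      hermPart n (swExponent n k p * H₀.mat + swBlock n k p - H₀.mat * swExponent n k p) := by
  intro X
  have hX (i j : Fin n) : star (X.mat j i) = X.mat i j := X.isHermitian.apply i j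
  -- Solve the commutator equation entrywise; conjugation changes the sign of `i` and the transpose
  -- that of the gap, so `S` is Hermitian.
  let S : Herm n := ⟨of fun i j => if ((i : ℕ) < k ↔ (j : ℕ) < k) then 0 else
    X.mat i j / (Complex.I * (eig H₀ j - eig H₀ i : ℝ)), by
      change star _ = _
      ext i j
      rw [star_apply, of_apply, of_apply]
      by_cases hij : ((i : ℕ) < k ↔ (j : ℕ) < k)
      · rw [if_pos hij, if_pos hij.symm, star_zero]
      · rw [if_neg hij, if_neg (fun hc => hij hc.symm), star_div₀, hX, star_mul]
        congr 1
        simp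
        ring⟩
  let B : Herm n := ⟨of fun i j => if ((i : ℕ) < k ∨ (j : ℕ) < k) then 0 else X.mat i j, by
      change star _ = _
      ext i j
      rw [star_apply, of_apply, of_apply]
      by_cases hij : ((i : ℕ) < k ∨ (j : ℕ) < k)
      · rw [if_pos hij, if_pos hij.symm, star_zero]
      · rw [if_neg hij, if_neg (fun hc => hij hc.symm), hX]⟩
  -- The mean of the upper diagonal, the only scalar that makes `E` traceless.
  let c : ℝ := (∑ i : Fin k, (X.mat (Fin.castLE hk i) (Fin.castLE hk i)).re) / k
  let E : Herm n := ⟨of fun i j => if (k ≤ (i : ℕ) ∨ k ≤ (j : ℕ)) then 0 else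
    X.mat i j - if i = j then (c : ℂ) else 0, by
      change star _ = _
      ext i j
      rw [star_apply, of_apply, of_apply]
      by_cases hij : (k ≤ (i : ℕ) ∨ k ≤ (j : ℕ))
      · rw [if_pos hij, if_pos hij.symm, star_zero]
      · rw [if_neg hij, if_neg (fun hc => hij hc.symm), star_sub, hX]
        congr 1
        by_cases hij' : i = j
        · simp [hij']
        · simp [hij', Ne.symm hij']⟩
  have hk0 : (k : ℝ) ≠ 0 := by
    have : k ≠ 0 := by omega
    exact_mod_cast this
  have hEtr : E.mat.trace = 0 := by
    have h1 : E.mat.trace = ∑ i : Fin n, if (i : ℕ) < k then X.mat i i - c else 0 := by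
      refine Finset.sum_congr rfl fun i _ => ?_
      change (if (k ≤ (i : ℕ) ∨ k ≤ (i : ℕ)) then 0 else
        X.mat i i - if i = i then (c : ℂ) else 0) = _
      by_cases hi : (i : ℕ) < k
      · simp [hi]
      · simp [hi, not_lt.1 hi]
    rw [h1, ← sum_castLE hk fun i => X.mat i i - (c : ℂ), Finset.sum_sub_distrib]
    have h2 (i : Fin n) : X.mat i i = ((X.mat i i).re : ℂ) :=
      (Complex.conj_eq_iff_re.1 (hX i i)).symm
    have h3 : ∑ i : Fin k, X.mat (Fin.castLE hk i) (Fin.castLE hk i) = ((c * k : ℝ) : ℂ) := by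
      simp only [c]
      rw [div_mul_cancel₀ _ hk0, Complex.ofReal_sum]
      exact Finset.sum_congr rfl fun i _ => h2 _
    rw [h3]
    simp [mul_comm]
  let p : SWData n k := (⟨S, fun i j hij => if_pos hij⟩, ⟨B, fun i j hij => if_pos hij⟩, c,
    ⟨E, fun i j hij => if_pos hij, hEtr⟩)
  refine ⟨p, Subtype.ext ?_⟩
  ext i j
  by_cases hij : ((i : ℕ) < k ↔ (j : ℕ) < k)
  · by_cases hi : (i : ℕ) < k
    · refine (swDeriv_apply_upper h p hi (hij.1 hi)).trans ?_
      have : p.eff.1.mat i j = X.mat i j - if i = j then (c : ℂ) else 0 :=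
        if_neg (by push Not; exact ⟨hi, hij.1 hi⟩)
      rw [this]
      exact add_sub_cancel _ _
    · have hj : ¬ (j : ℕ) < k := fun hc => hi (hij.2 hc)
      refine (swDeriv_apply_lower h p (not_lt.1 hi) (not_lt.1 hj)).trans ?_
      exact if_neg (by tauto)
  · refine (swDeriv_apply_off h p hij).trans ?_
    have h1 : p.S i j = X.mat i j / (Complex.I * (eig H₀ j - eig H₀ i : ℝ)) := if_neg hij
    have h2 : ((eig H₀ j - eig H₀ i : ℝ) : ℂ) ≠ 0 := by exact_mod_cast h.eig_ne hij
    rw [h1]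
    field_simp [Complex.I_ne_zero]

theorem toHerm_zero (H₀ : Herm n) : (0 : SWData n k).toHerm H₀ = hermPart n H₀.mat := by
  rw [toHerm_eq_hermPart, map_zero, map_zero, neg_zero, NormedSpace.exp_zero, one_mul, mul_one,
    add_zero]

theorem hermPart_mat (H : Herm n) : hermPart n H.mat = H :=
  Subtype.ext (hermPart_of_star_eq H.2)

end

end SchriefferWolff

namespace SchriefferWolff

open Matrix

variable {n k m : ℕ}

/-! ### Existence of the decomposition near a base point -/

theorem finiteDimensional_SWData : FiniteDimensional ℝ (SWData n k) := Module.Finite.prod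

/-- Near `0`, the decomposition map is an analytic diffeomorphism. -/
theorem exists_openPartialHomeomorph_toHerm (hk₁ : 1 ≤ k) (hk : k ≤ n) {H₀ : Herm n}
    (h : IsBasePoint k H₀) :
    ∃ Φ : OpenPartialHomeomorph (SWData n k) (Herm n), 0 ∈ Φ.source ∧
      (∀ p, Φ p = p.toHerm H₀) ∧ AnalyticAt ℝ Φ.symm H₀ := by
  have := finiteDimensional_SWData (n := n) (k := k)
  have hb : Function.Bijective fun p : SWData n k => hermPart n
      (swExponent n k p * H₀.mat + swBlock n k p - H₀.mat * swExponent n k p) :=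
    ⟨swDeriv_injective hk₁ hk h, swDeriv_surjective hk₁ hk h⟩
  obtain ⟨Φ, h0, hΦ, han⟩ := exists_openPartialHomeomorph_exp_conj (E := SWData n k)
    (F := Herm n) (A := Matrix (Fin n) (Fin n) ℂ) (swExponent n k) (swBlock n k)
    (hermPart n) H₀.mat (by convert hb)
  refine ⟨Φ, h0, fun p => ?_, ?_⟩
  · rw [toHerm_eq_hermPart]
    exact hΦ p
  · rw [hermPart_mat] at han
    exact han

theorem SWData.blockHerm_zero (H₀ : Herm n) : (0 : SWData n k).blockHerm H₀ = H₀ := by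
  apply Subtype.ext
  change H₀.mat + 0 + ((0 : ℝ) : ℂ) • blockOne n k + 0 = H₀.mat
  simp

theorem analyticAt_blockHerm (H₀ : Herm n) (p : SWData n k) :
    AnalyticAt ℝ (SWData.blockHerm H₀) p := by
  have := finiteDimensional_SWData (n := n) (k := k)
  have h1 : SWData.blockHerm (k := k) H₀ = fun p => H₀ +
      LinearMap.toContinuousLinearMap (hermPart n ∘ₗ swBlock n k) p := by
    funext p
    change _ = H₀ + hermPart n (swBlock n k p)
    nth_rw 2 [← hermPart_mat H₀]
    rw [← map_add]
    refine Subtype.ext ?_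
    rw [← hermPart_mat (p.blockHerm H₀)]
    change (hermPart n (H₀.mat + p.B + p.T + p.eff.1.mat)).mat =
      (hermPart n (H₀.mat + (p.B + p.T + p.eff.1.mat))).mat
    rw [← add_assoc, ← add_assoc]
  rw [h1]
  exact analyticAt_const.add (ContinuousLinearMap.analyticAt _ _)

/-- The decomposition `p` has a gap: the eigenvalues of the upper left block lie below those of the
lower right block. -/
def SWData.Gap (H₀ : Herm (k + m)) (p : SWData (k + m) k) : Prop :=
  ∀ i j, eig (upperBlock k m (p.blockHerm H₀)) i < eig (lowerRightBlock k m (p.blockHerm H₀)) j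

theorem isOpen_setOf_gap (H₀ : Herm (k + m)) :
    IsOpen {p : SWData (k + m) k | p.Gap H₀} := by
  have hc : Continuous (SWData.blockHerm (k := k) H₀) :=
    continuous_iff_continuousAt.2 fun p => (analyticAt_blockHerm H₀ p).continuousAt
  have hu : Continuous (upperBlock k m) := LinearMap.continuous_of_finiteDimensional _
  have hl : Continuous (lowerRightBlock k m) := LinearMap.continuous_of_finiteDimensional _
  simp only [SWData.Gap, Set.ofPred_forall]
  refine isOpen_iInter_of_finite fun i => isOpen_iInter_of_finite fun j => isOpen_lt ?_ ?_
  · exact (continuous_eig i).comp (hu.comp hc)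
  · exact (continuous_eig j).comp (hl.comp hc)

theorem IsBasePoint.gap_zero {H₀ : Herm (k + m)} (h : IsBasePoint k H₀) :
    (0 : SWData (k + m) k).Gap H₀ := by
  intro i j
  rw [SWData.blockHerm_zero]
  have hu : eig (upperBlock k m H₀) = fun i => eig H₀ (Fin.castAdd m i) := by
    refine eig_eq_of_diagonalization (fun a b hab => eig_monotone H₀ (by exact hab))
      (one_mem _) ?_
    change H₀.mat.submatrix _ _ = _
    rw [star_one, one_mul, mul_one, h.mat_eq, submatrix_diagonal _ _ (Fin.castAdd_injective k m)]
    rfl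
  have hl : eig (lowerRightBlock k m H₀) = fun i => eig H₀ (Fin.natAdd k i) := by
    refine eig_eq_of_diagonalization (fun a b hab => eig_monotone H₀ (by simpa using hab))
      (one_mem _) ?_
    change H₀.mat.submatrix _ _ = _
    rw [star_one, one_mul, mul_one, h.mat_eq, submatrix_diagonal _ _ (Fin.natAdd_injective m k)]
    rfl
  rw [hu, hl]
  exact (h.mem (Fin.castAdd m i) (Fin.natAdd k j) i.2).2 (by simp)

theorem IsBasePoint.blockHerm_offDiag {H₀ : Herm (k + m)} (h : IsBasePoint k H₀)
    (p : SWData (k + m) k) (i : Fin k) (j : Fin m) :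
    (p.blockHerm H₀).mat (Fin.castAdd m i) (Fin.natAdd k j) = 0 := by
  have hi : ((Fin.castAdd m i : Fin (k + m)) : ℕ) < k := i.2
  have hj : k ≤ ((Fin.natAdd k j : Fin (k + m)) : ℕ) := by simp
  have hne : Fin.castAdd m i ≠ Fin.natAdd k j := fun hc => by rw [hc] at hi; omega
  have h1 : H₀.mat (Fin.castAdd m i) (Fin.natAdd k j) = 0 := h.diag hne
  have h2 : p.B (Fin.castAdd m i) (Fin.natAdd k j) = 0 := p.2.1.2 _ _ (Or.inl hi)
  have h3 : p.eff.1.mat (Fin.castAdd m i) (Fin.natAdd k j) = 0 := p.eff.2.1 _ _ (Or.inr hj)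
  change H₀.mat _ _ + p.B _ _ + p.2.2.1 * blockOne (k + m) k _ _ + p.eff.1.mat _ _ = 0
  rw [h1, h2, h3, blockOne, diagonal_apply_ne _ hne]
  simp

/-- With a gap, the ordered eigenvalues are those of the upper left block followed by those of the
lower right block, and the data form a decomposition. -/
theorem IsBasePoint.eig_toHerm {H₀ : Herm (k + m)} (h : IsBasePoint k H₀)
    {p : SWData (k + m) k} (hp : p.Gap H₀) :
    eig (p.toHerm H₀) = Fin.append (eig (upperBlock k m (p.blockHerm H₀)))
      (eig (lowerRightBlock k m (p.blockHerm H₀))) ∧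
    IsSWDecomposition (Nat.le_add_right k m) H₀ (p.toHerm H₀) p := by
  -- `U W` diagonalizes `H`, and block diagonality of `W` keeps the span of the first `k` columns of
  -- `U`.
  obtain ⟨W, hW, hWc, hWd⟩ := exists_block_diagonalization _ (h.blockHerm_offDiag p)
  set f := Fin.append (eig (upperBlock k m (p.blockHerm H₀)))
      (eig (lowerRightBlock k m (p.blockHerm H₀))) with hf
  set U := NormedSpace.exp (Complex.I • p.S) with hUdef
  have hU : U ∈ unitary (Matrix (Fin (k + m)) (Fin (k + m)) ℂ) := p.exp_mem_unitary
  have hUW := mul_mem hU hW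
  have hH : (p.toHerm H₀).mat = (U * W) * diagonal (fun i => (f i : ℂ)) * star (U * W) := by
    have h1 : (p.toHerm H₀).mat = U * (p.blockHerm H₀).mat * star U := by
      rw [hUdef, p.star_exp]
      rfl
    rw [h1, hWd, star_mul]
    simp only [mul_assoc]
  have heig : eig (p.toHerm H₀) = f := eig_eq_of_diagonalization
    (monotone_append (eig_monotone _) (eig_monotone _) fun i j => (hp i j).le) hUW hH
  refine ⟨heig, rfl, ?_⟩
  rw [← hUdef, ← span_col_mul_unitary _ hW hWc, span_col_eq_iSup_eigenspace _ hUW hH]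
  · simp only [lowEig, heig]
  · intro i j hi hj
    induction i using Fin.addCases with
    | left i =>
      induction j using Fin.addCases with
      | left j => simp at hj; omega
      | right j => simpa [hf] using hp i j
    | right i => simp at hi

theorem isOpen_setOf_analyticAt {E F : Type*} [NormedAddCommGroup E] [NormedSpace ℝ E]
    [NormedAddCommGroup F] [NormedSpace ℝ F] [FiniteDimensional ℝ F] (f : E → F) :
    IsOpen {x | AnalyticAt ℝ f x} := by
  have := FiniteDimensional.complete ℝ F
  exact isOpen_analyticAt ℝ f

/-- The exact decomposition is defined near every base point. -/
theorem nonempty_SWDomain (hk₁ : 1 ≤ k) (hk : k ≤ n) {H₀ : Herm n} (h : IsBasePoint k H₀) :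
    Nonempty (SWDomain hk H₀) := by
  obtain ⟨m, rfl⟩ := Nat.exists_eq_add_of_le hk
  obtain ⟨Φ, h0, hΦ, han⟩ := exists_openPartialHomeomorph_toHerm hk₁ hk h
  have hΦ0 : Φ 0 = H₀ := by rw [hΦ, toHerm_zero, hermPart_mat]
  have hsymm : Φ.symm H₀ = 0 := by rw [← hΦ0, Φ.left_inv h0]
  have := finiteDimensional_SWData (n := k + m) (k := k)
  have hG := isOpen_setOf_gap (k := k) (m := m) H₀
  exact ⟨{
    -- The gap ensures that the block split off is the lowest one. Analyticity of the inverse is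
    -- known at `H₀` and spreads to a neighbourhood because it is an open condition.
    V := (Φ.target ∩ Φ.symm ⁻¹' {p | p.Gap H₀}) ∩ {H | AnalyticAt ℝ Φ.symm H}
    U := Φ.source ∩ {p | p.Gap H₀}
    isOpen_V := (Φ.isOpen_inter_preimage_symm hG).inter (isOpen_setOf_analyticAt Φ.symm)
    base_mem := by
      refine ⟨⟨hΦ0 ▸ Φ.map_source h0, ?_⟩, han⟩
      change (Φ.symm H₀).Gap H₀
      rw [hsymm]
      exact h.gap_zero
    isOpen_U := Φ.open_source.inter hG
    zero_mem := ⟨h0, h.gap_zero⟩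
    data := Φ.symm
    data_mem := fun H hH => ⟨Φ.map_target hH.1.1, hH.1.2⟩
    isDecomposition := fun H hH => by
      have h1 := (h.eig_toHerm (p := Φ.symm H) hH.1.2).2
      rw [← hΦ, Φ.right_inv hH.1.1] at h1
      exact h1
    unique := fun H hH p hp hd => by
      have h1 : p.toHerm H₀ = H := Subtype.ext hd.eq.symm
      rw [← h1, ← hΦ, Φ.left_inv hp.1]
    analytic := fun H hH => hH.2 }⟩

end SchriefferWolff

namespace SchriefferWolff

open Matrix Filter

variable {n k m : ℕ}

/-! ### Power series for the ordered eigenvalues -/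

/-- Multiplication by `s ≥ 0` preserves the ordering of the eigenvalues; this sign condition is what
confines the power series to `t ≥ 0`. -/
theorem eig_affine {X Y : Herm n} {s c : ℝ} (hs : 0 ≤ s)
    (h : Y.mat = (s : ℂ) • X.mat + (c : ℂ) • 1) (i : Fin n) : eig Y i = s * eig X i + c := by
  obtain ⟨W, hW, hX⟩ := exists_eig_diagonalization X
  refine congrFun (eig_eq_of_diagonalization (f := fun i => s * eig X i + c)
    (fun a b hab => ?_) hW ?_) i
  · have := mul_le_mul_of_nonneg_left (eig_monotone X hab) hs
    simpa using this
  · have hd : diagonal (fun i => ((s * eig X i + c : ℝ) : ℂ)) =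
        (s : ℂ) • diagonal (fun i => (eig X i : ℂ)) + (c : ℂ) • 1 := by
      rw [smul_one_eq_diagonal, ← diagonal_smul, diagonal_add]
      simp
    rw [hd, mul_add, add_mul, Matrix.mul_smul, Matrix.mul_smul, mul_one, Matrix.smul_mul,
      Matrix.smul_mul, Unitary.mul_star_self_of_mem hW, ← hX, h]

theorem mat_eq_of_eig_const {X : Herm n} {c : ℝ} (h : ∀ i, eig X i = c) :
    X.mat = (c : ℂ) • 1 := by
  obtain ⟨W, hW, hX⟩ := exists_eig_diagonalization X
  simp only [h] at hX
  rw [hX, ← smul_one_eq_diagonal, Matrix.mul_smul, mul_one, Matrix.smul_mul,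
    Unitary.mul_star_self_of_mem hW]

/-- Reduction to smaller blocks: eigenvalues of an analytic curve through a base point. -/
theorem rightAnalytic_eig_of_isBasePoint (hk₁ : 1 ≤ k) {A : ℝ → Herm (k + m)}
    (hA : AnalyticAt ℝ A 0) (h : IsBasePoint k (A 0))
    (ihk : ∀ B : ℝ → Herm k, AnalyticAt ℝ B 0 → ∀ i, RightAnalytic fun t => eig (B t) i)
    (ihm : ∀ B : ℝ → Herm m, AnalyticAt ℝ B 0 → ∀ i, RightAnalytic fun t => eig (B t) i)
    (i : Fin (k + m)) : RightAnalytic fun t => eig (A t) i := by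
  obtain ⟨Φ, h0, hΦ, han⟩ := exists_openPartialHomeomorph_toHerm hk₁ (Nat.le_add_right k m) h
  have hΦ0 : Φ 0 = A 0 := by rw [hΦ, toHerm_zero, hermPart_mat]
  have hsymm : Φ.symm (A 0) = 0 := by rw [← hΦ0, Φ.left_inv h0]
  set X : ℝ → Herm (k + m) := fun t => (Φ.symm (A t)).blockHerm (A 0)
  have hq : AnalyticAt ℝ (fun t => Φ.symm (A t)) 0 := han.fun_comp hA
  have hX : AnalyticAt ℝ X 0 := (analyticAt_blockHerm (A 0) _).fun_comp hq
  have htarget : ∀ᶠ t in 𝓝[≥] (0 : ℝ), A t ∈ Φ.target :=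
    (hA.continuousAt.eventually_mem (Φ.open_target.mem_nhds
      (by rw [← hΦ0]; exact Φ.map_source h0))).filter_mono nhdsWithin_le_nhds
  have hgap : ∀ᶠ t in 𝓝[≥] (0 : ℝ), (Φ.symm (A t)).Gap (A 0) := by
    refine (hq.continuousAt.eventually_mem ((isOpen_setOf_gap (A 0)).mem_nhds ?_)).filter_mono
      nhdsWithin_le_nhds
    change (Φ.symm (A 0)).Gap (A 0)
    rw [hsymm]
    exact h.gap_zero
  have heig : ∀ᶠ t in 𝓝[≥] (0 : ℝ), eig (A t) =
      Fin.append (eig (upperBlock k m (X t))) (eig (lowerRightBlock k m (X t))) := by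
    filter_upwards [htarget, hgap] with t h1 h2
    rw [← (h.eig_toHerm h2).1, ← hΦ, Φ.right_inv h1]
  have hu : AnalyticAt ℝ (fun t => upperBlock k m (X t)) 0 :=
    ((LinearMap.toContinuousLinearMap (upperBlock k m)).analyticAt _).fun_comp hX
  have hl : AnalyticAt ℝ (fun t => lowerRightBlock k m (X t)) 0 :=
    ((LinearMap.toContinuousLinearMap (lowerRightBlock k m)).analyticAt _).fun_comp hX
  induction i using Fin.addCases with
  | left i =>
    refine (ihk _ hu i).congr ?_
    filter_upwards [heig] with t ht
    rw [ht, Fin.append_left]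
  | right i =>
    refine (ihm _ hl i).congr ?_
    filter_upwards [heig] with t ht
    rw [ht, Fin.append_right]

/-- Conjugation by a matrix, as a linear map on Hermitian matrices. -/
noncomputable def hermConj (W : Matrix (Fin n) (Fin n) ℂ) : Herm n →ₗ[ℝ] Herm n where
  toFun X := ⟨star W * X.mat * W, by
    have := IsSelfAdjoint.conjugate (x := X.mat) X.2 (star W)
    rwa [star_star] at this⟩
  map_add' X Y := Subtype.ext (by
    change star W * (X.mat + Y.mat) * W = star W * X.mat * W + star W * Y.mat * W
    rw [mul_add, add_mul])
  map_smul' c X := Subtype.ext (by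
    change star W * (c • X.mat) * W = c • (star W * X.mat * W)
    rw [Matrix.mul_smul, Matrix.smul_mul])

theorem eig_hermConj {W : Matrix (Fin n) (Fin n) ℂ}
    (hW : W ∈ unitary (Matrix (Fin n) (Fin n) ℂ)) (X : Herm n) : eig (hermConj W X) = eig X := by
  refine eig_eq_of_charpoly (eig_monotone X) ?_
  change (star W * X.mat * W).charpoly = _
  rw [charpoly_mul_comm, ← mul_assoc, Unitary.mul_star_self_of_mem hW, one_mul,
    charpoly_eq_prod_eig]

/-- The eigenvalues of an analytic curve starting at a non-scalar matrix reduce to smaller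
matrices. -/
theorem rightAnalytic_eig_of_ne {A : ℝ → Herm n} (hA : AnalyticAt ℝ A 0)
    (hne : ∃ i j, eig (A 0) i ≠ eig (A 0) j)
    (ih : ∀ n' < n, ∀ B : ℝ → Herm n', AnalyticAt ℝ B 0 → ∀ i, RightAnalytic fun t => eig (B t) i)
    (i : Fin n) : RightAnalytic fun t => eig (A t) i := by
  obtain ⟨W, hW, hA0⟩ := exists_eig_diagonalization (A 0)
  have hn : 0 < n := i.pos
  have hex : ∃ k, ∃ hk : k < n, eig (A 0) ⟨k, hk⟩ ≠ eig (A 0) ⟨0, hn⟩ := by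
    by_contra hc
    push Not at hc
    obtain ⟨a, b, hab⟩ := hne
    exact hab ((hc a a.2).trans (hc b b.2).symm)
  -- The first index above the lowest level: the bottom cluster has size `k` with `1 ≤ k < n`, so
  -- both blocks are smaller than `n`.
  obtain ⟨k, ⟨hkn, hk⟩, hmin⟩ : ∃ k, (∃ hk : k < n, eig (A 0) ⟨k, hk⟩ ≠ eig (A 0) ⟨0, hn⟩) ∧
      ∀ j < k, ¬ ∃ hj : j < n, eig (A 0) ⟨j, hj⟩ ≠ eig (A 0) ⟨0, hn⟩ := by
    classical
    exact ⟨Nat.find hex, Nat.find_spec hex, fun j => Nat.find_min hex⟩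
  have hlow (j : Fin n) (hj : (j : ℕ) < k) : eig (A 0) j = eig (A 0) ⟨0, hn⟩ := by
    by_contra hc
    exact hmin j hj ⟨j.2, hc⟩
  have hhigh (j : Fin n) (hj : k ≤ (j : ℕ)) : eig (A 0) ⟨0, hn⟩ < eig (A 0) j :=
    lt_of_lt_of_le (lt_of_le_of_ne (eig_monotone _ (Fin.mk_le_mk.2 (Nat.zero_le _))) hk.symm)
      (eig_monotone (A 0) (a := ⟨k, hkn⟩) hj)
  have hk₁ : 1 ≤ k := by
    rw [Nat.one_le_iff_ne_zero]
    intro h0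
    exact hk (by congr)
  -- A fixed rotation diagonalizes the starting matrix, making it a base point without changing
  -- eigenvalues.
  set B : ℝ → Herm n := fun t => hermConj W (A t)
  have hB : AnalyticAt ℝ B 0 :=
    ((LinearMap.toContinuousLinearMap (hermConj W)).analyticAt _).fun_comp hA
  have heig (t : ℝ) : eig (B t) = eig (A t) := eig_hermConj hW _
  have hB0 : (B 0).mat = diagonal (fun i => (eig (A 0) i : ℂ)) := by
    change star W * (A 0).mat * W = _
    nth_rw 1 [hA0]
    rw [mul_assoc, mul_assoc, Unitary.star_mul_self_of_mem hW, mul_one, ← mul_assoc,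
      Unitary.star_mul_self_of_mem hW, one_mul]
  have hbase : IsBasePoint k (B 0) := by
    refine ⟨fun a b ha => ?_, ?_, ?_⟩
    · rw [heig, hlow a ha]
      exact ⟨fun hb => (hlow b hb).symm, fun hb => hhigh b hb⟩
    · rw [hB0]
      exact isDiag_diagonal _
    · rw [hB0]
      simpa using eig_monotone (A 0)
  simp only [← heig]
  clear_value B
  clear hex hk hmin hlow hhigh hB0 heig hA0 hne hA hW W A hn
  obtain ⟨m, rfl⟩ := Nat.exists_eq_add_of_le hkn.le
  exact rightAnalytic_eig_of_isBasePoint hk₁ hB hbase (ih k hkn) (ih m (by omega)) i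

/-- The normalized trace. -/
noncomputable def meanTrace (n : ℕ) : Herm n →ₗ[ℝ] ℝ where
  toFun X := (trace X.mat).re / n
  map_add' X Y := by
    change (trace (X.mat + Y.mat)).re / n = _
    rw [trace_add, Complex.add_re, add_div]
  map_smul' c X := by
    change (trace (c • X.mat)).re / n = c * ((trace X.mat).re / n)
    rw [trace_smul, Complex.smul_re, smul_eq_mul, mul_div_assoc]

/-- **Rellich's theorem** for eigenvalues: along an analytic curve of Hermitian matrices, the
ordered eigenvalues are power series on the right of `0`. -/
theorem rightAnalytic_eig {A : ℝ → Herm n} (hA : AnalyticAt ℝ A 0) (i : Fin n) :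
    RightAnalytic fun t => eig (A t) i := by
  induction n using Nat.strong_induction_on with
  | _ n ih =>
    have hn : (n : ℝ) ≠ 0 := by exact_mod_cast i.pos.ne'
    set one : Herm n := ⟨1, star_one _⟩
    set c : ℝ → ℝ := fun t => meanTrace n (A t) with hc
    have hca : AnalyticAt ℝ c 0 :=
      ((LinearMap.toContinuousLinearMap (meanTrace n)).analyticAt _).fun_comp hA
    set A₀ : ℝ → Herm n := fun t => A t - c t • one with hA₀
    have hA₀a : AnalyticAt ℝ A₀ 0 := hA.fun_sub (hca.fun_smul analyticAt_const)
    have hone : meanTrace n one = 1 := by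
      change (trace (1 : Matrix (Fin n) (Fin n) ℂ)).re / n = 1
      rw [trace_one]
      simp [hn]
    have htr (t : ℝ) : meanTrace n (A₀ t) = 0 := by
      simp only [hA₀, map_sub, map_smul, hone, hc]
      simp
    have hmat (t : ℝ) : (A t).mat = (A₀ t).mat + (c t : ℂ) • 1 := by
      change (A t).mat = (A t).mat - c t • (1 : Matrix (Fin n) (Fin n) ℂ) + _
      rw [← Complex.coe_smul]
      abel
    -- If the traceless part vanishes identically near `0`, the curve is scalar and every eigenvalue
    -- is `c t`.
    by_cases htop : analyticOrderAt A₀ 0 = ⊤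
    · refine hca.rightAnalytic.congr ?_
      filter_upwards [(analyticOrderAt_eq_top.1 htop).filter_mono nhdsWithin_le_nhds] with t ht
      rw [eig_affine (X := one) (s := 0) (c := c t) le_rfl]
      · simp
      · rw [hmat, ht]
        simp
    · obtain ⟨N, hN⟩ := ENat.ne_top_iff_exists.1 htop
      obtain ⟨g, hg, hg0, hAg⟩ := hA₀a.analyticOrderAt_eq_natCast.1 hN.symm
      -- For `t > 0` dividing by `t^N` keeps the trace zero; pass to the limit.
      have htrg : meanTrace n (g 0) = 0 := by
        have h1 : Tendsto (fun t => meanTrace n (g t)) (𝓝[>] 0) (𝓝 (meanTrace n (g 0))) :=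
          (((meanTrace n).continuous_of_finiteDimensional.continuousAt).comp
            hg.continuousAt).mono_left nhdsWithin_le_nhds
        refine tendsto_nhds_unique h1 (tendsto_const_nhds.congr' ?_)
        filter_upwards [hAg.filter_mono nhdsWithin_le_nhds, self_mem_nhdsWithin] with t ht ht0
        have ht0 : 0 < t := ht0
        have h2 := htr t
        rw [ht, map_smul, smul_eq_mul, sub_zero] at h2
        exact ((mul_eq_zero.1 h2).resolve_left (pow_pos ht0 N).ne').symm
      -- A traceless scalar matrix is zero, but `g 0 ≠ 0`.
      have hne : ∃ a b, eig (g 0) a ≠ eig (g 0) b := by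
        by_contra hcon
        push Not at hcon
        have h1 := mat_eq_of_eig_const (X := g 0) (c := eig (g 0) i) fun a => hcon a i
        have h2 : g 0 = eig (g 0) i • one := by
          apply Subtype.ext
          change (g 0).mat = eig (g 0) i • (1 : Matrix (Fin n) (Fin n) ℂ)
          rw [← Complex.coe_smul]
          exact h1
        have h3 := htrg
        rw [h2, map_smul, hone, smul_eq_mul, mul_one] at h3
        rw [h3, zero_smul] at h2
        exact hg0 h2
      have hge := rightAnalytic_eig_of_ne hg hne (fun n' hn' B hB i => ih n' hn' hB i) i
      have hp : AnalyticAt ℝ (fun t : ℝ => t ^ N) 0 := by fun_prop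
      refine ((hp.rightAnalytic.mul hge).add hca.rightAnalytic).congr ?_
      filter_upwards [hAg.filter_mono nhdsWithin_le_nhds, self_mem_nhdsWithin] with t ht ht0
      have ht0 : 0 ≤ t := ht0
      refine eig_affine (pow_nonneg ht0 N) ?_ i
      rw [hmat, ht, sub_zero]
      congr 1

end SchriefferWolff

namespace SchriefferWolff

open Filter Asymptotics

variable {n k : ℕ}

/-! ### Orders of splitting, distance and effective Hamiltonian -/

theorem eventually_gap {H : ℝ → Herm n} (hH : ContinuousAt H 0) (hH₀ : H 0 ∈ degenerate n k) :
    ∀ᶠ t in 𝓝 (0 : ℝ), ∀ i j : Fin n, (i : ℕ) < k → k ≤ (j : ℕ) → eig (H t) i < eig (H t) j := by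
  simp only [eventually_all]
  intro i j hi hj
  exact (((continuous_eig i).continuousAt.comp hH).eventually_lt
    ((continuous_eig j).continuousAt.comp hH) ((hH₀ i j hi).2 hj))

/-- Coordinates are bounded by the norm, and the vector is a finite combination of basis vectors, so
the growth bounds agree. An empty basis, as for `k = 1`, gives `⊤` on both sides. -/
theorem analyticAt_repr_and_iInf_order {E ι : Type*} [Fintype ι] [NormedAddCommGroup E]
    [NormedSpace ℝ E] [FiniteDimensional ℝ E] (c : Module.Basis ι ℝ E) {F : ℝ → E}
    (hF : AnalyticAt ℝ F 0) :
    (∀ j, AnalyticAt ℝ (fun t => c.repr (F t) j) 0) ∧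
      (⨅ j, analyticOrderAt (fun t => c.repr (F t) j) 0) = analyticOrderAt F 0 := by
  have han (j : ι) : AnalyticAt ℝ (fun t => c.repr (F t) j) 0 :=
    ((LinearMap.toContinuousLinearMap (c.coord j)).analyticAt _).fun_comp hF
  refine ⟨han, ENat.eq_of_forall_natCast_le_iff fun N => ?_⟩
  rw [le_iInf_iff, natCast_le_analyticOrderAt_iff_isBigO hF]
  constructor
  · intro h
    have h1 : F = fun t => ∑ j, c.repr (F t) j • c j := by
      funext t
      exact (c.sum_repr (F t)).symm
    rw [h1]
    refine IsBigO.fun_sum fun j _ => ?_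
    have h2 := (natCast_le_analyticOrderAt_iff_isBigO (han j)).1 (h j)
    simpa using h2.smul (isBigO_const_const (c j) (one_ne_zero (α := ℝ)) _)
  · intro h j
    rw [natCast_le_analyticOrderAt_iff_isBigO (han j)]
    exact ((LinearMap.toContinuousLinearMap (c.coord j)).isBigO_comp F _).trans h

end SchriefferWolff

open SchriefferWolff in
theorem mainTheorem4 (n k : ℕ) (hk₁ : 1 ≤ k) (hk : k ≤ n)
    (H : ℝ → Herm n) (hH : AnalyticAt ℝ H 0) (hH₀ : H 0 ∈ degenerate n k) :
    -- the splitting functions and the distance are power series for `t ≥ 0`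
    (RightAnalytic (fun t => stdDev hk (H t)) ∧
      (∀ i j : Fin k, RightAnalytic (fun t => splitting hk i j (H t))) ∧
      (∀ i : Fin k, RightAnalytic (fun t => meanSplitting hk i (H t))) ∧
      RightAnalytic (fun t => Metric.infDist (H t) (degenerate n k))) ∧
    -- the decomposition is defined near every base point
    (∀ H₀' : Herm n, IsBasePoint k H₀' → Nonempty (SWDomain hk H₀')) ∧
    -- the order `r` of energy splitting, measured in any of the five ways, and its other values
    ∃ r : ℕ∞,
      rightOrd (fun t => stdDev hk (H t)) = r ∧
      (⨅ (i : Fin k) (j : Fin k) (_ : i < j), rightOrd (fun t => splitting hk i j (H t))) = r ∧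
      (⨅ (i : Fin k) (j : Fin k) (_ : (i : ℕ) + 1 = (j : ℕ)),
        rightOrd (fun t => splitting hk i j (H t))) = r ∧
      rightOrd (fun t => splitting hk ⟨0, by omega⟩ ⟨k - 1, by omega⟩ (H t)) = r ∧
      (⨅ i : Fin k, rightOrd (fun t => meanSplitting hk i (H t))) = r ∧
      rightOrd (fun t => Metric.infDist (H t) (degenerate n k)) = r ∧
      ∀ H₀' : Herm n, IsBasePoint k H₀' → ∀ D : SWDomain hk H₀', H 0 ∈ D.V →
        AnalyticAt ℝ (fun t => (D.data (H t)).eff) 0 ∧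
        analyticOrderAt (fun t => (D.data (H t)).eff) 0 = r ∧
        ∀ c : Module.Basis (Fin (k ^ 2 - 1)) ℝ (hermZero n k),
          (∀ j, AnalyticAt ℝ (fun t => c.repr (D.data (H t)).eff j) 0) ∧
          (⨅ j, analyticOrderAt (fun t => c.repr (D.data (H t)).eff j) 0) = r := by
  have hlow (i : Fin k) : RightAnalytic fun t => lowEig hk (H t) i := rightAnalytic_eig hH _
  have hinv : RightAnalytic fun _ => (k : ℝ)⁻¹ := AnalyticAt.rightAnalytic analyticAt_const
  have hmean : RightAnalytic fun t => meanEig hk (H t) := by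
    simp only [meanEig, div_eq_mul_inv]
    exact (RightAnalytic.sum hlow).mul hinv
  have hsplit (i j : Fin k) : RightAnalytic fun t => splitting hk i j (H t) :=
    (hlow i).sub (hlow j)
  have hmsplit (i : Fin k) : RightAnalytic fun t => meanSplitting hk i (H t) := (hlow i).sub hmean
  have hscaled : RightAnalytic fun t => Real.sqrt k * stdDev hk (H t) := by
    simp only [sqrt_mul_stdDev hk₁]
    exact RightAnalytic.sqrt_sum_sq hmsplit
  have hk0 : Real.sqrt k ≠ 0 := (Real.sqrt_pos.2 (by exact_mod_cast hk₁)).ne'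
  have hstd : RightAnalytic fun t => stdDev hk (H t) := by
    refine ((AnalyticAt.rightAnalytic (f := fun _ => (Real.sqrt k)⁻¹) analyticAt_const).mul
      hscaled).congr (.of_forall fun t => ?_)
    simp only
    rw [inv_mul_cancel_left₀ hk0]
  have hgap := eventually_gap hH.continuousAt hH₀
  have hdisteq : ∀ᶠ t in 𝓝 (0 : ℝ),
      Metric.infDist (H t) (degenerate n k) = Real.sqrt k * stdDev hk (H t) :=
    hgap.mono fun t ht => infDist_degenerate hk₁ hk ht
  have hdist : RightAnalytic fun t => Metric.infDist (H t) (degenerate n k) :=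
    hscaled.congr (hdisteq.filter_mono nhdsWithin_le_nhds)
  have htfae (N : ℕ) := splitting_isBigO_tfae hk₁ (l := fun i t => lowEig hk (H t) i)
    (fun t a b hab => eig_monotone (H t) (by exact hab)) N
  refine ⟨⟨hstd, hsplit, hmsplit, hdist⟩, fun H₀' h => nonempty_SWDomain hk₁ hk h,
    rightOrd fun t => stdDev hk (H t), rfl, ?_, ?_, ?_, ?_, ?_, ?_⟩
  -- An element of `ℕ∞` is determined by the naturals below it, and a lower bound on an infimum is a
  -- bound on each term; empty infima are `⊤`.
  · refine ENat.eq_of_forall_natCast_le_iff fun N => ?_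
    simp only [le_iInf_iff, hstd.natCast_le_rightOrd_iff, (hsplit _ _).natCast_le_rightOrd_iff]
    exact (htfae N).out 1 0
  · refine ENat.eq_of_forall_natCast_le_iff fun N => ?_
    simp only [le_iInf_iff, hstd.natCast_le_rightOrd_iff, (hsplit _ _).natCast_le_rightOrd_iff]
    exact (htfae N).out 2 0
  · refine ENat.eq_of_forall_natCast_le_iff fun N => ?_
    simp only [hstd.natCast_le_rightOrd_iff, (hsplit _ _).natCast_le_rightOrd_iff]
    exact (htfae N).out 3 0
  · refine ENat.eq_of_forall_natCast_le_iff fun N => ?_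
    simp only [le_iInf_iff, hstd.natCast_le_rightOrd_iff, (hmsplit _).natCast_le_rightOrd_iff]
    exact (htfae N).out 4 0
  · refine ENat.eq_of_forall_natCast_le_iff fun N => ?_
    rw [hdist.natCast_le_rightOrd_iff, hstd.natCast_le_rightOrd_iff]
    refine (Asymptotics.isBigO_congr (hdisteq.filter_mono nhdsWithin_le_nhds) .rfl).trans ?_
    exact Asymptotics.isBigO_const_mul_left_iff hk0
  · intro H₀' hbase D hD
    have hdata : AnalyticAt ℝ (fun t => D.data (H t)) 0 := (D.analytic _ hD).fun_comp hH
    have heff : AnalyticAt ℝ (fun t => (D.data (H t)).eff) 0 :=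
      analyticAt_snd.fun_comp (analyticAt_snd.fun_comp (analyticAt_snd.fun_comp hdata))
    have hV : ∀ᶠ t in 𝓝 (0 : ℝ), H t ∈ D.V :=
      hH.continuousAt.eventually_mem (D.isOpen_V.mem_nhds hD)
    -- The norm identity does not involve the choice of `H₀'`: its scalar upper block is absorbed in
    -- the mean. Hence the base point need not be `H 0`.
    have hnorm : ∀ᶠ t in 𝓝 (0 : ℝ), ‖(D.data (H t)).eff‖ = Real.sqrt k * stdDev hk (H t) :=
      hV.mono fun t ht => (D.isDecomposition _ ht).norm_eff hk₁ hbase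
    have hord : analyticOrderAt (fun t => (D.data (H t)).eff) 0 =
        rightOrd fun t => stdDev hk (H t) := by
      refine ENat.eq_of_forall_natCast_le_iff fun N => ?_
      rw [natCast_le_analyticOrderAt_iff_isBigO heff, hstd.natCast_le_rightOrd_iff,
        ← Asymptotics.isBigO_norm_left]
      refine (Asymptotics.isBigO_congr (hnorm.filter_mono nhdsWithin_le_nhds) .rfl).trans ?_
      exact Asymptotics.isBigO_const_mul_left_iff hk0
    refine ⟨heff, hord, fun c => ?_⟩
    rw [← hord]
    exact analyticAt_repr_and_iInf_order c heff
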